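/- Let $\mathbf{FI}$ be the category of finite sets and injections and $\mathbf{FB}$ the category of finite sets and bijections. An $\mathbf{FI}$-module (respectively $\mathbf{FB}$-module) is a functor from $\mathbf{FI}$ (respectively $\mathbf{FB}$) to the category of $\mathbb{Z}$-modules. For an $\mathbf{FB}$-module $W$ let $$\deg(W) := \min\{d \ge -1 : W_S = 0 \text{ whenever } |S| > d\} \in \{-1,0,1,2,\dots\}\cup\{\infty\}.$$ Let $\mathrm{H}_0^{\mathbf{FI}}$ be the left adjoint of the functor from $\mathbf{FB}$-modules to $\mathbf{FI}$-modules that extends an $\mathbf{FB}$-module by letting non-bijective injections act as zero; explicitly, $$\mathrm{H}_0^{\mathbf{FI}}(V)_S = \operatorname{coker}\Big(\bigoplus_{T \subsetneq S} V_T \to V_S\Big).$$ Let $\mathrm{H}_i^{\mathbf{FI}}$ be its $i$-th left derived functor. An $\mathbf{FI}$-module $V$ is \emph{$\mathrm{H}_0^{\mathbf{FI}}$-acyclic} if $\mathrm{H}_i^{\mathbf{FI}}(V) = 0$ for all $i \ge 1$, and it is \emph{generated in degrees $\le g$} if $\deg(\mathrm{H}_0^{\mathbf{FI}}(V)) \le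 g$. Let $C_\star$ be a chain complex of $\mathbf{FI}$-modules indexed by $\mathbb{Z}$ (with differentials $C_k \to C_{k-1}$), and let $(g_k)_{k\in\mathbb{Z}}$ be integers such that for every $k \in \mathbb{Z}$ the $\mathbf{FI}$-module $C_k$ is $\mathrm{H}_0^{\mathbf{FI}}$-acyclic and generated in degrees $\le g_k$. Then for every $k \in \mathbb{Z}$ with $g_k \ge 0$, the homology $\mathrm{H}_k(C_\star)$ is generated in degrees $$\le \begin{cases} g_{k-1} + g_k + 1 & \text{if } g_k > g_{k-1}, \\ 2 g_k & \text{if } g_k \le g_{k-1}. \end{cases}$$ -/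

import Mathlib

open CategoryTheory CategoryTheory.Limits

universe u

/-- The objects of the category `FI`: finite sets. -/
structure FI : Type 1 where
  carrier : Type
  [finite : Finite carrier]

attribute [instance] FI.finite

/-- The category `FI` of finite sets and injections. -/
instance FI.category : Category.{0} FI where
  Hom S T := S.carrier ↪ T.carrier
  id S := Function.Embedding.refl S.carrier
  comp f g := Function.Embedding.trans f g

/-- The objects of the category `FB`: finite sets. -/
structure FB : Type 1 where
  carrier : Type
  [finite : Finite carrier]

attribute [instance] FB.finite

/-- The category `FB` of finite sets and bijections. -/
instance FB.category : Category.{0} FB where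
  Hom S T := S.carrier ≃ T.carrier
  id S := Equiv.refl S.carrier
  comp f g := Equiv.trans f g

/-- An injection of finite sets, as a morphism of `FI`. -/
def FI.ofEmb {S T : FI} (f : S.carrier ↪ T.carrier) : S ⟶ T := f

/-- The injection underlying a morphism of `FI`. -/
def FI.emb {S T : FI} (f : S ⟶ T) : S.carrier ↪ T.carrier := f

/-- A bijection of finite sets, as a morphism of `FB`. -/
def FB.ofEquiv {S T : FB} (f : S.carrier ≃ T.carrier) : S ⟶ T := f

/-- The bijection underlying a morphism of `FB`. -/
def FB.equiv {S T : FB} (f : S ⟶ T) : S.carrier ≃ T.carrier := f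

theorem FI.hom_ext {S T : FI} {f g : S ⟶ T} (h : ∀ x, FI.emb f x = FI.emb g x) : f = g :=
  Function.Embedding.ext h

theorem FB.hom_ext {S T : FB} {f g : S ⟶ T} (h : ∀ x, FB.equiv f x = FB.equiv g x) : f = g :=
  Equiv.ext h

/-- The category of `FI`-modules: functors from `FI` to abelian groups. -/
abbrev FIModule : Type (u + 1) := FI ⥤ ModuleCat.{u} ℤ

/-- The category of `FB`-modules: functors from `FB` to abelian groups. -/
abbrev FBModule : Type (u + 1) := FB ⥤ ModuleCat.{u} ℤ

/-! ### The category of `FI`-modules has enough projectives -/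

namespace FIModule

/-- The `FI`-module `S ↦ ℤ[Hom_FI(A, S)]` represented by the finite set `A`. -/
noncomputable def free (A : FI) : FIModule.{u} where
  obj S := ModuleCat.of ℤ ((ULift.{u} (A ⟶ S)) →₀ ℤ)
  map {S T} f := ModuleCat.ofHom
    (Finsupp.lmapDomain ℤ ℤ (fun h : ULift.{u} (A ⟶ S) => ULift.up (h.down ≫ f)))
  map_id S := by
    ext : 1
    refine Finsupp.lhom_ext' fun a => LinearMap.ext_ring ?_
    simp
  map_comp f g := by
    ext : 1
    refine Finsupp.lhom_ext' fun a => LinearMap.ext_ring ?_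
    simp

/-- The morphism from a represented `FI`-module to `V` that corresponds to an element of `V_A`. -/
noncomputable def fromFree (A : FI) (V : FIModule.{u}) (x : V.obj A) : free.{u} A ⟶ V where
  app S := ModuleCat.ofHom
    (Finsupp.linearCombination ℤ (fun h : ULift.{u} (A ⟶ S) => (V.map h.down).hom x))
  naturality S T f := by
    ext : 1
    refine Finsupp.lhom_ext' fun a => LinearMap.ext_ring ?_
    simp [free]

/-- The universal element of a represented `FI`-module. -/
noncomputable def univ (A : FI) : (free.{u} A).obj A :=
  Finsupp.single (ULift.up (𝟙 A)) (1 : ℤ)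

theorem fromFree_single (A : FI) (V : FIModule.{u}) (x : V.obj A) (S : FI) (h : A ⟶ S) :
    ((fromFree A V x).app S).hom (Finsupp.single (ULift.up h) (1 : ℤ)) = (V.map h).hom x := by
  change Finsupp.linearCombination ℤ (fun h : ULift.{u} (A ⟶ S) => (V.map h.down).hom x)
    (Finsupp.single (ULift.up h) (1 : ℤ)) = _
  rw [Finsupp.linearCombination_single]
  exact @one_smul ℤ (V.obj S) _ (V.obj S).isModule.toMulAction _

theorem free_hom_ext {A : FI} {V : FIModule.{u}} {α β : free.{u} A ⟶ V}
    (h : (α.app A).hom (univ A) = (β.app A).hom (univ A)) : α = β := by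
  ext S : 2
  ext : 1
  refine Finsupp.lhom_ext' fun a => LinearMap.ext_ring ?_
  have key : ∀ γ : free.{u} A ⟶ V, (γ.app S).hom (Finsupp.single a (1 : ℤ)) =
      (V.map a.down).hom ((γ.app A).hom (univ A)) := by
    intro γ
    have := congrArg (fun φ => φ.hom (univ A)) (γ.naturality a.down)
    simp only [ModuleCat.hom_comp, LinearMap.comp_apply] at this
    rw [← this]
    congr 1
    change _ = Finsupp.mapDomain (fun h : ULift.{u} (A ⟶ A) => ULift.up (h.down ≫ a.down))
      (Finsupp.single (ULift.up (𝟙 A)) (1 : ℤ))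
    rw [Finsupp.mapDomain_single, Category.id_comp]
  change (α.app S).hom (Finsupp.single a (1 : ℤ)) = (β.app S).hom (Finsupp.single a (1 : ℤ))
  rw [key, key, h]

instance projective_free (A : FI) : Projective (free.{u} A) where
  factors {E X} f e he := by
    have : Epi (e.app A) := (NatTrans.epi_iff_epi_app e).1 he A
    obtain ⟨y, hy⟩ := (ModuleCat.epi_iff_surjective _).1 this ((f.app A).hom (univ A))
    refine ⟨fromFree A E y, free_hom_ext ?_⟩
    have h1 := fromFree_single A E y A (𝟙 A)
    simp only [NatTrans.comp_app, ModuleCat.hom_comp, LinearMap.comp_apply]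
    rw [univ, h1, E.map_id]
    exact hy

theorem projective_sigma {β : Type u} (P : β → FIModule.{u}) [∀ b, Projective (P b)] :
    Projective (∐ P) where
  factors f e _ := ⟨Sigma.desc fun b => Projective.factorThru (Sigma.ι P b ≫ f) e, by
    ext b : 1
    simp⟩

instance enoughProjectives : EnoughProjectives FIModule.{u} where
  presentation V := by
    let β : Type u := Σ n : ℕ, V.obj ⟨Fin n⟩
    let P : β → FIModule.{u} := fun b => free.{u} ⟨Fin b.1⟩
    let π : (∐ P) ⟶ V := Sigma.desc fun b => fromFree ⟨Fin b.1⟩ V b.2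
    have hπ : Epi π := by
      rw [NatTrans.epi_iff_epi_app]
      intro S
      rw [ModuleCat.epi_iff_surjective]
      intro x
      obtain ⟨n, ⟨e⟩⟩ := Finite.exists_equiv_fin S.carrier
      let i : S ⟶ (⟨Fin n⟩ : FI) := FI.ofEmb e.toEmbedding
      let j : (⟨Fin n⟩ : FI) ⟶ S := FI.ofEmb e.symm.toEmbedding
      have hij : i ≫ j = 𝟙 S := FI.hom_ext fun s => e.symm_apply_apply s
      let b : β := ⟨n, (V.map i).hom x⟩
      refine ⟨((Sigma.ι P b).app S).hom (Finsupp.single (ULift.up j) (1 : ℤ)), ?_⟩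
      have h1 : Sigma.ι P b ≫ π = fromFree ⟨Fin n⟩ V ((V.map i).hom x) :=
        Sigma.ι_desc _ b
      have h2 := fromFree_single ⟨Fin n⟩ V ((V.map i).hom x) S j
      rw [← h1] at h2
      have h3 : (V.map j).hom ((V.map i).hom x) = x := by
        rw [← LinearMap.comp_apply, ← ModuleCat.hom_comp, ← V.map_comp, hij, V.map_id]
        rfl
      rw [h3] at h2
      exact h2
    have hP : ∀ b, Projective (P b) := fun b => projective_free ⟨Fin b.1⟩
    have : Projective (∐ P) := projective_sigma P
    exact ⟨{ p := ∐ P, f := π }⟩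

end FIModule

/-! ### `FI`-homology -/

/-- The inclusion of a subset `T ⊆ S`, as a morphism of `FI`. -/
def FI.incl {S : FI} (T : Set S.carrier) : (⟨T⟩ : FI) ⟶ S :=
  FI.ofEmb (Function.Embedding.subtype (· ∈ T))

namespace FIModule

/-- The image of `⨁_{T ⊊ S} V_T → V_S`. -/
def decomposables (V : FIModule.{u}) (S : FI) : Submodule ℤ (V.obj S) :=
  ⨆ T : {T : Set S.carrier // T ≠ Set.univ}, LinearMap.range (V.map (FI.incl T.1)).hom

theorem map_mem_decomposables (V : FIModule.{u}) {T S : FI} (f : T ⟶ S)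
    (hf : ¬ Function.Surjective (FI.emb f)) (x : V.obj T) :
    (V.map f).hom x ∈ V.decomposables S := by
  have hT : Set.range (FI.emb f) ≠ Set.univ := fun h => hf (Set.range_eq_univ.1 h)
  let p : T ⟶ (⟨Set.range (FI.emb f)⟩ : FI) :=
    FI.ofEmb ⟨fun t => ⟨FI.emb f t, t, rfl⟩,
      fun a b h => (FI.emb f).injective (congrArg Subtype.val h)⟩
  have hp : f = p ≫ FI.incl (Set.range (FI.emb f)) := rfl
  refine Submodule.mem_iSup_of_mem ⟨_, hT⟩ ⟨(V.map p).hom x, ?_⟩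
  rw [← LinearMap.comp_apply, ← ModuleCat.hom_comp, ← V.map_comp, ← hp]

end FIModule

/-- The inclusion functor from `FB` to `FI`. -/
def FB.toFI : FB ⥤ FI where
  obj S := ⟨S.carrier⟩
  map f := FI.ofEmb (FB.equiv f).toEmbedding

namespace FIModule

theorem decomposables_le_comap (V : FIModule.{u}) {S S' : FB} (e : S ⟶ S') :
    V.decomposables (FB.toFI.obj S) ≤
      (V.decomposables (FB.toFI.obj S')).comap (V.map (FB.toFI.map e)).hom := by
  refine iSup_le fun T => ?_
  rintro _ ⟨x, rfl⟩
  rw [Submodule.mem_comap, ← LinearMap.comp_apply, ← ModuleCat.hom_comp, ← V.map_comp]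
  refine V.map_mem_decomposables _ (fun h => T.2 (Set.eq_univ_of_forall fun s => ?_)) x
  obtain ⟨t, ht⟩ := h (FB.equiv e s)
  have hts : t.1 = s := (FB.equiv e).injective ht
  exact hts ▸ t.2

theorem decomposables_le_comap_app {V W : FIModule.{u}} (φ : V ⟶ W) (S : FI) :
    V.decomposables S ≤ (W.decomposables S).comap (φ.app S).hom := by
  refine iSup_le fun T => ?_
  rintro _ ⟨x, rfl⟩
  refine Submodule.mem_iSup_of_mem T ⟨(φ.app _).hom x, ?_⟩
  exact (congrArg (fun ψ => ψ.hom x) (φ.naturality (FI.incl T.1))).symm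

end FIModule

/-- The quotient of a module by a submodule, as an object of the category of modules. -/
abbrev ModuleCat.quot {R : Type} [Ring R] (M : ModuleCat.{u} R) (N : Submodule R M) :
    ModuleCat.{u} R :=
  ModuleCat.of R (M ⧸ N)

/-- The projection onto a quotient module. -/
def ModuleCat.quotMk {R : Type} [Ring R] {M : ModuleCat.{u} R} (N : Submodule R M) :
    M ⟶ M.quot N :=
  ModuleCat.ofHom N.mkQ

/-- The map out of a quotient module induced by a map that kills the submodule. -/
def ModuleCat.quotLift {R : Type} [Ring R] {M M' : ModuleCat.{u} R} {N : Submodule R M}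
    (f : M ⟶ M') (h : N ≤ LinearMap.ker f.hom) : M.quot N ⟶ M' :=
  ModuleCat.ofHom (N.liftQ f.hom h)

/-- The map of quotient modules induced by a map of modules. -/
def ModuleCat.quotMap {R : Type} [Ring R] {M M' : ModuleCat.{u} R} {N : Submodule R M}
    {N' : Submodule R M'} (f : M ⟶ M') (h : N ≤ N'.comap f.hom) : M.quot N ⟶ M'.quot N' :=
  ModuleCat.ofHom (Submodule.mapQ N N' f.hom h)

theorem ModuleCat.quot_hom_ext {R : Type} [Ring R] {M M' : ModuleCat.{u} R} {N : Submodule R M}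
    {α β : M.quot N ⟶ M'} (h : ModuleCat.quotMk N ≫ α = ModuleCat.quotMk N ≫ β) : α = β :=
  ModuleCat.hom_ext (Submodule.linearMap_qext _ (congrArg ModuleCat.Hom.hom h))

theorem ModuleCat.quotMk_map {R : Type} [Ring R] {M M' : ModuleCat.{u} R} {N : Submodule R M}
    {N' : Submodule R M'} (f : M ⟶ M') (h : N ≤ N'.comap f.hom) :
    ModuleCat.quotMk N ≫ ModuleCat.quotMap f h = f ≫ ModuleCat.quotMk N' := rfl

theorem ModuleCat.quotMk_lift {R : Type} [Ring R] {M M' : ModuleCat.{u} R} {N : Submodule R M}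
    (f : M ⟶ M') (h : N ≤ LinearMap.ker f.hom) :
    ModuleCat.quotMk N ≫ ModuleCat.quotLift f h = f := rfl

/-- The functor `H₀ : FI-modules ⥤ FB-modules`,
`H₀(V)_S = coker (⨁_{T ⊊ S} V_T → V_S)`. -/
def FIH0 : FIModule.{u} ⥤ FBModule.{u} where
  obj V :=
    { obj := fun S => (V.obj (FB.toFI.obj S)).quot (V.decomposables (FB.toFI.obj S))
      map := fun e => ModuleCat.quotMap (V.map (FB.toFI.map e)) (V.decomposables_le_comap e)
      map_id := fun S => ModuleCat.quot_hom_ext <| by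
        rw [ModuleCat.quotMk_map, FB.toFI.map_id, V.map_id, Category.id_comp, Category.comp_id]
      map_comp := fun e e' => ModuleCat.quot_hom_ext <| by
        rw [ModuleCat.quotMk_map, FB.toFI.map_comp, V.map_comp]
        rfl }
  map φ :=
    { app := fun S => ModuleCat.quotMap (φ.app (FB.toFI.obj S))
        (FIModule.decomposables_le_comap_app φ (FB.toFI.obj S))
      naturality := fun S S' e => ModuleCat.quot_hom_ext <| by
        dsimp only
        rw [← Category.assoc, ← Category.assoc, ModuleCat.quotMk_map, ModuleCat.quotMk_map,
          Category.assoc, Category.assoc, ModuleCat.quotMk_map, ModuleCat.quotMk_map,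
          ← Category.assoc, ← Category.assoc, φ.naturality] }
  map_id V := NatTrans.ext (funext fun _ => ModuleCat.quot_hom_ext rfl)
  map_comp φ ψ := NatTrans.ext (funext fun _ => ModuleCat.quot_hom_ext rfl)

instance FIH0_additive : FIH0.{u}.Additive where
  map_add := NatTrans.ext (funext fun _ => ModuleCat.quot_hom_ext rfl)

open Classical in
/-- The functor `π^* : FB-modules ⥤ FI-modules` that lets non-bijective injections act as zero. -/
noncomputable def piStar : FBModule.{u} ⥤ FIModule.{u} where
  obj W :=
    { obj := fun S => W.obj ⟨S.carrier⟩
      map := fun {S T} f =>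
        if h : Function.Bijective (FI.emb f) then
          W.map (FB.ofEquiv (S := ⟨S.carrier⟩) (T := ⟨T.carrier⟩) (Equiv.ofBijective _ h))
        else 0
      map_id := fun S => by
        have h : Function.Bijective (FI.emb (𝟙 S)) := Function.bijective_id
        rw [dif_pos h, ← W.map_id]
        exact congrArg W.map (FB.hom_ext fun x => rfl)
      map_comp := fun {S T U} f g => by
        have hc : ⇑(FI.emb (f ≫ g)) = FI.emb g ∘ FI.emb f := rfl
        by_cases hf : Function.Bijective (FI.emb f)
        · by_cases hg : Function.Bijective (FI.emb g)
          · have hfg : Function.Bijective (FI.emb (f ≫ g)) := hc ▸ hg.comp hf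
            rw [dif_pos hf, dif_pos hg, dif_pos hfg, ← W.map_comp]
            exact congrArg W.map (FB.hom_ext fun x => rfl)
          · have hfg : ¬ Function.Bijective (FI.emb (f ≫ g)) := fun h =>
              hg ((Function.Bijective.of_comp_iff _ hf).1 (hc ▸ h))
            rw [dif_neg hg, dif_neg hfg, comp_zero]
        · have hfg : ¬ Function.Bijective (FI.emb (f ≫ g)) := fun h => hf
            ⟨(FI.emb f).injective, fun t => by
              obtain ⟨s, hs⟩ := h.2 (FI.emb g t)
              exact ⟨s, (FI.emb g).injective hs⟩⟩
          rw [dif_neg hf, dif_neg hfg, zero_comp] }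
  map {W W'} φ :=
    { app := fun S => φ.app ⟨S.carrier⟩
      naturality := fun S T f => by
        by_cases hf : Function.Bijective (FI.emb f)
        · simp [dif_pos hf]
        · simp [dif_neg hf] }

theorem piStar_map_of_not_surjective (W : FBModule.{u}) {S T : FI} (f : S ⟶ T)
    (hf : ¬ Function.Surjective (FI.emb f)) : (piStar.obj W).map f = 0 :=
  dif_neg fun h => hf h.2

theorem piStar_map_toFI (W : FBModule.{u}) {S T : FB} (e : S ⟶ T) :
    (piStar.obj W).map (FB.toFI.map e) = W.map e :=
  (dif_pos (FB.equiv e).bijective).trans (congrArg W.map (FB.hom_ext fun _ => rfl))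

theorem piStar_decomposables (W : FBModule.{u}) (S : FI) :
    (piStar.obj W).decomposables S = ⊥ := by
  refine le_bot_iff.1 (iSup_le fun T => ?_)
  rw [piStar_map_of_not_surjective W (FI.incl T.1) fun h => T.2 (Set.eq_univ_of_forall fun s => by
    obtain ⟨t, ht⟩ := h s
    exact ht ▸ t.2)]
  rintro _ ⟨x, rfl⟩
  rfl

/-- `H₀` is the left adjoint of `π^*`. -/
noncomputable def FIH0Adjunction : FIH0.{u} ⊣ piStar.{u} where
  unit :=
    { app := fun V =>
        { app := fun S => ModuleCat.quotMk (V.decomposables S)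
          naturality := fun S T f => by
            by_cases hf : Function.Surjective (FI.emb f)
            · let e : (⟨S.carrier⟩ : FB) ⟶ ⟨T.carrier⟩ :=
                FB.ofEquiv (Equiv.ofBijective (FI.emb f) ⟨(FI.emb f).injective, hf⟩)
              have h : (piStar.obj (FIH0.obj V)).map f = (FIH0.obj V).map e :=
                piStar_map_toFI (FIH0.obj V) e
              exact (congrArg (fun ψ => ModuleCat.quotMk (V.decomposables S) ≫ ψ) h).symm
            · have h : (piStar.obj (FIH0.obj V)).map f = 0 :=
                piStar_map_of_not_surjective (FIH0.obj V) f hf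
              refine Eq.trans ?_
                (congrArg (fun ψ => ModuleCat.quotMk (V.decomposables S) ≫ ψ) h).symm
              refine ModuleCat.hom_ext (LinearMap.ext fun x => ?_)
              exact (Submodule.Quotient.mk_eq_zero _).2 (V.map_mem_decomposables f hf x) }
      naturality := fun V W φ => rfl }
  counit :=
    { app := fun W =>
        { app := fun S => ModuleCat.quotLift (𝟙 (W.obj S))
            ((piStar_decomposables W (FB.toFI.obj S)).trans_le bot_le)
          naturality := fun S T e => ModuleCat.quot_hom_ext (piStar_map_toFI W e) }
      naturality := fun W W' φ =>
        NatTrans.ext (funext fun _ => ModuleCat.quot_hom_ext rfl) }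
  left_triangle_components V :=
    NatTrans.ext (funext fun _ => ModuleCat.quot_hom_ext rfl)
  right_triangle_components W := NatTrans.ext (funext fun _ => rfl)

/-- The degree of an `FB`-module `W`: the least `d ≥ -1` such that `W_S = 0` for all finite sets
`S` with `|S| > d`, or `∞` if there is none. -/
noncomputable def FBModule.deg (W : FBModule.{u}) : WithTop ℤ :=
  sInf {d : WithTop ℤ | ((-1 : ℤ) : WithTop ℤ) ≤ d ∧
    ∀ S : FB, d < (Nat.card S.carrier : ℤ) → IsZero (W.obj S)}

theorem FBModule.deg_le_iff (W : FBModule.{u}) (d : ℤ) :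
    W.deg ≤ (d : WithTop ℤ) ↔
      -1 ≤ d ∧ ∀ S : FB, d < (Nat.card S.carrier : ℤ) → IsZero (W.obj S) := by
  have hglb := WithTop.isGLB_sInf' (s := {d : WithTop ℤ | ((-1 : ℤ) : WithTop ℤ) ≤ d ∧
    ∀ S : FB, d < (Nat.card S.carrier : ℤ) → IsZero (W.obj S)})
    ⟨((-1 : ℤ) : WithTop ℤ), fun _ h => h.1⟩
  constructor
  · intro h
    have h1 : ((-1 : ℤ) : WithTop ℤ) ≤ W.deg := hglb.2 fun _ h => h.1
    refine ⟨WithTop.coe_le_coe.1 (h1.trans h), fun S hS => ?_⟩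
    by_contra hne
    have h2 : ((Nat.card S.carrier : ℤ) : WithTop ℤ) ≤ W.deg :=
      hglb.2 fun e he => not_lt.1 fun hlt => hne (he.2 S hlt)
    exact absurd (WithTop.coe_le_coe.1 (h2.trans h)) (not_le.2 hS)
  · rintro ⟨h1, h2⟩
    refine hglb.1 ⟨WithTop.coe_le_coe.2 h1, fun S hS => h2 S (WithTop.coe_lt_coe.1 hS)⟩

/-- The `i`-th `FI`-homology functor, the `i`-th left derived functor of `H₀`. -/
noncomputable def FIHomology (i : ℕ) : FIModule.{u} ⥤ FBModule.{u} :=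
  FIH0.leftDerived i

/-- `V` is generated in degrees `≤ g` if `t₀(V) = deg H₀(V) ≤ g`. -/
def FIModule.GeneratedInDegreesLE (V : FIModule.{u}) (g : ℤ) : Prop :=
  FBModule.deg (FIH0.obj V) ≤ (g : WithTop ℤ)

/-- `V` is `H₀`-acyclic if its higher `FI`-homology vanishes. -/
def FIModule.IsH0Acyclic (V : FIModule.{u}) : Prop :=
  ∀ i : ℕ, 1 ≤ i → IsZero ((FIHomology i).obj V)

/-! Let `Q` be the cokernel of `C_k → C_{k-1}`, `I` the image and `Z` the kernel. Since `H_k` is a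
quotient of `Z`, it is enough to bound the generation degree of `Z`. The sequences `0 → Z → C_k → I
→ 0` and `0 → I → C_{k-1} → Q → 0`, with the vanishing of `H₁(C_{k-1})`, show that `Q` is generated
in degrees `≤ g_{k-1}`, that `H₁(Q)` lives in degrees `≤ g_k`, and that `Z` is generated in degrees
`≤ max(g_k, deg H₂(Q))`. This is `isZero_koszulHomology_zero_kernel`.

What remains is a regularity estimate: `deg H₂ ≤ t₀ + t₁ + 1`
(`isZero_koszulHomology_two_of_lt_add`) and `deg H₂ ≤ 2 t₁`
(`isZero_koszulHomology_two_of_lt_two_mul`), where `t₀`, `t₁` bound the degrees of `H₀`, `H₁`. Both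
go by induction along the derivative `D = coker(V → ΣV)`, where `ΣV = V_{- ⊔ {*}}`: passing to `D`
lowers `t₀` and `t₁` by one, and a bound on `H₂(D)` returns one on `H₂(V)` once the kernel of `V →
ΣV` is known to vanish in high degrees.

Homology at `[n]` is computed by a Koszul complex built recursively, `koszul (n + 1) V` being the
cone of `koszul n V → koszul n (ΣV)`. Hence vanishing at `n + 1` is a statement about the map
induced by `V → ΣV` at `n`. The comparison with the derived functors is needed only in two places:
`H₀` at `[n]` is the degree zero Koszul homology, and `FIHomology 1` vanishing forces the first
Koszul homology to vanish. -/

/-! ### Mapping cones: long exact sequence, functoriality, exactness. -/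

section MappingCone

open HomologicalComplex

variable {A : Type*} [Category* A] [Abelian A]

/-- A short complex which is a direct sum of two short exact sequences is short exact. -/
theorem CategoryTheory.ShortComplex.shortExact_of_decomposition {S F G : ShortComplex A}
    (hF : F.ShortExact) (hG : G.ShortExact) (fst : S ⟶ F) (snd : S ⟶ G) (inl : F ⟶ S)
    (inr : G ⟶ S) (h : fst ≫ inl + snd ≫ inr = 𝟙 S) : S.ShortExact := by
  have := hF.mono_f
  have := hG.mono_f
  have := hF.epi_g
  have := hG.epi_g
  have h₁ : fst.τ₁ ≫ inl.τ₁ + snd.τ₁ ≫ inr.τ₁ = 𝟙 _ := congrArg ShortComplex.Hom.τ₁ h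
  have h₂ : fst.τ₂ ≫ inl.τ₂ + snd.τ₂ ≫ inr.τ₂ = 𝟙 _ := congrArg ShortComplex.Hom.τ₂ h
  have h₃ : fst.τ₃ ≫ inl.τ₃ + snd.τ₃ ≫ inr.τ₃ = 𝟙 _ := congrArg ShortComplex.Hom.τ₃ h
  refine { exact := ?_, mono_f := ?_, epi_g := ?_ }
  · rw [ShortComplex.exact_iff_exact_up_to_refinements]
    intro Z a ha
    have hb : (a ≫ fst.τ₂) ≫ F.g = 0 := by
      rw [Category.assoc, fst.comm₂₃, reassoc_of% ha, zero_comp]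
    have hc : (a ≫ snd.τ₂) ≫ G.g = 0 := by
      rw [Category.assoc, snd.comm₂₃, reassoc_of% ha, zero_comp]
    refine ⟨Z, 𝟙 Z, inferInstance,
      hF.exact.lift _ hb ≫ inl.τ₁ + hG.exact.lift _ hc ≫ inr.τ₁, ?_⟩
    rw [Preadditive.add_comp, Category.assoc, Category.assoc, inl.comm₁₂, inr.comm₁₂,
      hF.exact.lift_f_assoc, hG.exact.lift_f_assoc, Category.assoc, Category.assoc,
      ← Preadditive.comp_add, h₂, Category.comp_id, Category.id_comp]
  · refine Preadditive.mono_of_cancel_zero _ fun {Z} a ha => ?_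
    have hb : a ≫ fst.τ₁ = 0 := by
      rw [← cancel_mono F.f, Category.assoc, fst.comm₁₂, reassoc_of% ha, zero_comp, zero_comp]
    have hc : a ≫ snd.τ₁ = 0 := by
      rw [← cancel_mono G.f, Category.assoc, snd.comm₁₂, reassoc_of% ha, zero_comp, zero_comp]
    rw [← Category.comp_id a, ← h₁, Preadditive.comp_add, reassoc_of% hb, reassoc_of% hc,
      zero_comp, zero_comp, add_zero]
  · refine Preadditive.epi_of_cancel_zero _ fun {Z} a ha => ?_
    have hb : inl.τ₃ ≫ a = 0 := by
      rw [← cancel_epi F.g, ← inl.comm₂₃_assoc, ha, comp_zero, comp_zero]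
    have hc : inr.τ₃ ≫ a = 0 := by
      rw [← cancel_epi G.g, ← inr.comm₂₃_assoc, ha, comp_zero, comp_zero]
    rw [← Category.id_comp a, ← h₃, Preadditive.add_comp, Category.assoc, Category.assoc, hb, hc,
      comp_zero, comp_zero, add_zero]

namespace CochainComplex

theorem epi_homologyMap_quotient_iff {K L : CochainComplex A ℤ} (φ : K ⟶ L) (n : ℤ) :
    Epi (((HomotopyCategory.homologyFunctor A (ComplexShape.up ℤ) n)).map
      ((HomotopyCategory.quotient A (ComplexShape.up ℤ)).map φ)) ↔ Epi (homologyMap φ n) :=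
  (MorphismProperty.epimorphisms A).arrow_mk_iso_iff
    (((Functor.mapArrowFunctor _ _).mapIso
      (HomotopyCategory.homologyFunctorFactors A (ComplexShape.up ℤ) n)).app (Arrow.mk φ))

theorem mono_homologyMap_quotient_iff {K L : CochainComplex A ℤ} (φ : K ⟶ L) (n : ℤ) :
    Mono (((HomotopyCategory.homologyFunctor A (ComplexShape.up ℤ) n)).map
      ((HomotopyCategory.quotient A (ComplexShape.up ℤ)).map φ)) ↔ Mono (homologyMap φ n) :=
  (MorphismProperty.monomorphisms A).arrow_mk_iso_iff
    (((Functor.mapArrowFunctor _ _).mapIso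
      (HomotopyCategory.homologyFunctorFactors A (ComplexShape.up ℤ) n)).app (Arrow.mk φ))

theorem isZero_homology_mappingCone_iff {K L : CochainComplex A ℤ} (φ : K ⟶ L)
    (n₀ n₁ : ℤ) (h : n₀ + 1 = n₁) :
    IsZero ((mappingCone φ).homology n₀) ↔
      Epi (homologyMap φ n₀) ∧ Mono (homologyMap φ n₁) := by
  rw [← epi_homologyMap_quotient_iff, ← mono_homologyMap_quotient_iff]
  have hT := HomotopyCategory.mappingCone_triangleh_distinguished φ
  let F := HomotopyCategory.homologyFunctor A (ComplexShape.up ℤ) 0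
  have h1 := F.homologySequence_epi_shift_map_mor₁_iff _ hT n₀
  have h2 := F.homologySequence_mono_shift_map_mor₁_iff _ hT n₀ n₁ h
  have h3 := (F.homologySequence_exact₃ _ hT n₀ n₁ h).isZero_X₂_iff
  refine Iff.trans ?_ (h3.trans (and_congr h1 h2).symm)
  exact ((HomotopyCategory.homologyFunctorFactors A (ComplexShape.up ℤ) n₀).app
    (mappingCone φ)).symm.isZero_iff

theorem homologyMap_comp_inr {K L : CochainComplex A ℤ} (φ : K ⟶ L) (n : ℤ) :
    homologyMap φ n ≫ homologyMap (mappingCone.inr φ) n = 0 := by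
  rw [← homologyMap_comp]
  exact ((homotopyCofiber.inrCompHomotopy φ fun j => ⟨j - 1, by simp⟩).homologyMap_eq n).trans
    (homologyMap_zero _ _ _)

theorem exact_homologyMap_inr {K L : CochainComplex A ℤ} (φ : K ⟶ L) (n : ℤ) :
    (ShortComplex.mk _ _ (homologyMap_comp_inr φ n)).Exact := by
  have hT := HomotopyCategory.mappingCone_triangleh_distinguished φ
  let F := HomotopyCategory.homologyFunctor A (ComplexShape.up ℤ) 0
  let e := HomotopyCategory.homologyFunctorFactors A (ComplexShape.up ℤ) n
  refine ShortComplex.exact_of_iso ?_ (F.homologySequence_exact₂ _ hT n)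
  exact ShortComplex.isoMk (e.app K) (e.app L) (e.app (mappingCone φ))
    (e.hom.naturality φ).symm (e.hom.naturality (mappingCone.inr φ)).symm

theorem epi_homologyMap_inr {K L : CochainComplex A ℤ} (φ : K ⟶ L) (n₀ n₁ : ℤ)
    (h : n₀ + 1 = n₁) (hK : IsZero (K.homology n₁)) :
    Epi (homologyMap (mappingCone.inr φ) n₀) := by
  rw [← epi_homologyMap_quotient_iff]
  have hT := HomotopyCategory.mappingCone_triangleh_distinguished φ
  let F := HomotopyCategory.homologyFunctor A (ComplexShape.up ℤ) 0
  have h1 := F.homologySequence_epi_shift_map_mor₂_iff _ hT n₀ n₁ h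
  refine h1.2 (IsZero.eq_of_tgt ?_ _ _)
  exact ((HomotopyCategory.homologyFunctorFactors A (ComplexShape.up ℤ) n₁).app
    K).isZero_iff.2 hK

end CochainComplex

namespace CategoryTheory.Functor

open CochainComplex

variable {B : Type*} [Category* B]

/-- The functor sending `X` to the mapping cone of `α_X : F(X) ⟶ G(X)`. -/
noncomputable def mappingCone {F G : B ⥤ CochainComplex A ℤ} (α : F ⟶ G) :
    B ⥤ CochainComplex A ℤ where
  obj X := CochainComplex.mappingCone (α.app X)
  map f := mappingCone.map _ _ (F.map f) (G.map f) (α.naturality f).symm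
  map_id X := by
    simp only [F.map_id, G.map_id]
    exact mappingCone.map_id _
  map_comp f g := by
    simp only [F.map_comp, G.map_comp]
    exact mappingCone.map_comp _ _ _ _ _ _ _ _ _

/-- The inclusion of the target in the mapping cone, as a natural transformation. -/
noncomputable def mappingConeInr {F G : B ⥤ CochainComplex A ℤ} (α : F ⟶ G) :
    G ⟶ mappingCone α where
  app X := mappingCone.inr (α.app X)
  naturality X Y f := by simp [mappingCone, mappingCone.map]

variable [HasZeroMorphisms B]

instance preservesZeroMorphisms_mappingCone {F G : B ⥤ CochainComplex A ℤ} (α : F ⟶ G)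
    [F.PreservesZeroMorphisms] [G.PreservesZeroMorphisms] :
    (mappingCone α).PreservesZeroMorphisms where
  map_zero X Y := by
    ext i
    refine (mappingCone.ext_from_iff (α.app X) (i + 1) i rfl _ _).2 ⟨?_, ?_⟩
    all_goals simp [mappingCone, mappingCone.map]
    all_goals exact comp_zero.symm

/-- In degree `i` the cone is `F^{i+1} ⊕ G^i`, and maps induced by functoriality are diagonal for
this splitting; only the differential mixes the summands. -/
theorem shortExact_map_mappingCone {F G : B ⥤ CochainComplex A ℤ} (α : F ⟶ G)
    [F.PreservesZeroMorphisms] [G.PreservesZeroMorphisms] (S : ShortComplex B)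
    (hF : (S.map F).ShortExact) (hG : (S.map G).ShortExact) :
    (S.map (mappingCone α)).ShortExact := by
  refine shortExact_of_degreewise_shortExact _ fun i => ?_
  have fst {X Y : B} (f : X ⟶ Y) : (mappingCone.fst (α.app X)).1.v i (i + 1) rfl ≫
      (F.map f).f (i + 1) = ((mappingCone α).map f).f i ≫
      (mappingCone.fst (α.app Y)).1.v i (i + 1) rfl := by
    simp [mappingCone, mappingCone.map, mappingCone.ext_from_iff _ (i + 1) i rfl]
  have snd {X Y : B} (f : X ⟶ Y) : (mappingCone.snd (α.app X)).v i i (add_zero i) ≫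
      (G.map f).f i = ((mappingCone α).map f).f i ≫
      (mappingCone.snd (α.app Y)).v i i (add_zero i) := by
    simp [mappingCone, mappingCone.map, mappingCone.ext_from_iff _ (i + 1) i rfl]
  have inl {X Y : B} (f : X ⟶ Y) : (mappingCone.inl (α.app X)).v (i + 1) i (by lia) ≫
      ((mappingCone α).map f).f i =
        (F.map f).f (i + 1) ≫ (mappingCone.inl (α.app Y)).v (i + 1) i (by lia) := by
    simp [mappingCone, mappingCone.map]
  have inr {X Y : B} (f : X ⟶ Y) : (mappingCone.inr (α.app X)).f i ≫
      ((mappingCone α).map f).f i =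
        (G.map f).f i ≫ (mappingCone.inr (α.app Y)).f i := by
    simp [mappingCone, mappingCone.map]
  refine ShortComplex.shortExact_of_decomposition
    (hF.map_of_exact (HomologicalComplex.eval A (ComplexShape.up ℤ) (i + 1)))
    (hG.map_of_exact (HomologicalComplex.eval A (ComplexShape.up ℤ) i))
    ⟨_, _, _, fst S.f, fst S.g⟩ ⟨_, _, _, snd S.f, snd S.g⟩
    ⟨_, _, _, inl S.f, inl S.g⟩ ⟨_, _, _, inr S.f, inr S.g⟩ ?_
  ext
  all_goals exact (mappingCone.id_X _ i (i + 1) rfl)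

end CategoryTheory.Functor

end MappingCone

/-! ### The shift functor and the Koszul complex. -/

namespace FI

/-- The endofunctor `S ↦ S ⊔ {*}` of `FI`. -/
def addPoint : FI ⥤ FI where
  obj S := ⟨Option S.carrier⟩
  map f := ofEmb (emb f).optionMap
  map_id S := hom_ext fun x => by cases x <;> rfl
  map_comp f g := hom_ext fun x => by cases x <;> rfl

/-- The inclusion `S ⟶ S ⊔ {*}`. -/
def toAddPoint : 𝟭 FI ⟶ addPoint where
  app S := ofEmb Function.Embedding.some

/-- The standard finite set with `n` elements, obtained by adding `n` points to the empty set. -/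
def std : ℕ → FI
  | 0 => ⟨Empty⟩
  | n + 1 => addPoint.obj (std n)

theorem card_std (n : ℕ) : Nat.card (std n).carrier = n := by
  induction n with
  | zero => exact Nat.card_of_isEmpty (α := Empty)
  | succ n ih => exact (Finite.card_option (α := (std n).carrier)).trans (congrArg (· + 1) ih)

end FI

namespace FIModule

/-- The shift functor `V ↦ V_{- ⊔ {*}}`. -/
def shift : FIModule.{u} ⥤ FIModule.{u} :=
  (Functor.whiskeringLeft FI FI (ModuleCat.{u} ℤ)).obj FI.addPoint

/-- The natural map `V ⟶ V_{- ⊔ {*}}`. -/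
def toShift : 𝟭 FIModule.{u} ⟶ shift.{u} where
  app V :=
    { app := fun S => V.map (FI.toAddPoint.app S)
      naturality := fun S T f => by
        change V.map f ≫ _ = _ ≫ V.map (FI.addPoint.map f)
        rw [← V.map_comp, ← V.map_comp]
        exact congrArg V.map (FI.toAddPoint.naturality f) }
  naturality V W φ := by
    ext S : 2
    exact (φ.naturality (FI.toAddPoint.app S)).symm

instance : shift.{u}.PreservesZeroMorphisms where
  map_zero _ _ := rfl

theorem shortExact_map_shift {S : ShortComplex FIModule.{u}} (hS : S.ShortExact) :
    (S.map shift).ShortExact := by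
  have : PreservesFiniteLimits shift.{u} := by unfold shift; infer_instance
  have : PreservesFiniteColimits shift.{u} := by unfold shift; infer_instance
  exact hS.map_of_exact _

/-- The complex computing `FI`-homology on the standard finite set with `n` elements. -/
noncomputable def koszul : ℕ → FIModule.{u} ⥤ CochainComplex (ModuleCat.{u} ℤ) ℤ
  | 0 => (evaluation FI (ModuleCat.{u} ℤ)).obj (FI.std 0) ⋙
      HomologicalComplex.single (ModuleCat.{u} ℤ) (ComplexShape.up ℤ) 0
  | n + 1 => Functor.mappingCone (F := koszul n) (G := shift ⋙ koszul n)
      (Functor.whiskerRight toShift (koszul n))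

instance preservesZeroMorphisms_koszul (n : ℕ) : (koszul.{u} n).PreservesZeroMorphisms := by
  induction n with
  | zero => unfold koszul; infer_instance
  | succ n ih => unfold koszul; infer_instance

theorem shortExact_map_koszul (n : ℕ) {S : ShortComplex FIModule.{u}} (hS : S.ShortExact) :
    (S.map (koszul n)).ShortExact := by
  induction n generalizing S with
  | zero =>
    have h := hS.map_of_exact ((evaluation FI (ModuleCat.{u} ℤ)).obj (FI.std 0))
    exact h.map_of_exact (HomologicalComplex.single (ModuleCat.{u} ℤ) (ComplexShape.up ℤ) 0)
  | succ n ih =>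
    exact Functor.shortExact_map_mappingCone _ S (ih hS) (ih (shortExact_map_shift hS))

/-- The `i`-th homology of the complex `koszul n`. -/
noncomputable def koszulHomology (n : ℕ) (i : ℤ) : FIModule.{u} ⥤ ModuleCat.{u} ℤ :=
  koszul n ⋙ HomologicalComplex.homologyFunctor _ _ (-i)

instance (n : ℕ) (i : ℤ) : (koszulHomology.{u} n i).PreservesZeroMorphisms := by
  unfold koszulHomology; infer_instance

section Sequence

variable {S : ShortComplex FIModule.{u}} (hS : S.ShortExact) (n : ℕ)

include hS

theorem exact_map_koszulHomology (i : ℤ) : (S.map (koszulHomology n i)).Exact :=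
  (shortExact_map_koszul n hS).homology_exact₂ (-i)

theorem exists_connecting (i j : ℤ) (h : i = j + 1) :
    ∃ (δ : (koszulHomology n i).obj S.X₃ ⟶ (koszulHomology n j).obj S.X₁)
      (h₁ : (koszulHomology n i).map S.g ≫ δ = 0) (h₂ : δ ≫ (koszulHomology n j).map S.f = 0),
      (ShortComplex.mk _ _ h₁).Exact ∧ (ShortComplex.mk _ _ h₂).Exact :=
  have hS' := shortExact_map_koszul n hS
  have hij : (ComplexShape.up ℤ).Rel (-i) (-j) := by simp [h]
  ⟨hS'.δ _ _ hij, hS'.comp_δ _ _ hij, hS'.δ_comp _ _ hij, hS'.homology_exact₃ _ _ hij,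
    hS'.homology_exact₁ _ _ hij⟩

end Sequence

/-- The long exact sequence of the cone defining `koszul (n + 1)`. Every induction on `n` passes
through this criterion. -/
theorem isZero_koszulHomology_succ_iff (V : FIModule.{u}) (n : ℕ) (i j : ℤ) (h : i = j + 1) :
    IsZero ((koszulHomology (n + 1) i).obj V) ↔
      Epi ((koszulHomology n i).map (toShift.app V)) ∧
        Mono ((koszulHomology n j).map (toShift.app V)) :=
  CochainComplex.isZero_homology_mappingCone_iff ((koszul n).map (toShift.app V)) (-i) (-j)
    (by lia)

theorem isZero_koszulHomology_zero (V : FIModule.{u}) (i : ℤ) (hi : i ≠ 0) :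
    IsZero ((koszulHomology 0 i).obj V) :=
  HomologicalComplex.isZero_single_obj_homology _ _ _ _ (by simpa using hi)

/-- The degree zero homology of `koszul 0` is the value on the empty set. -/
noncomputable def koszulHomologyZeroIso : koszulHomology.{u} 0 0 ≅
    (evaluation FI (ModuleCat.{u} ℤ)).obj (FI.std 0) :=
  Functor.isoWhiskerLeft ((evaluation FI (ModuleCat.{u} ℤ)).obj (FI.std 0))
    (HomologicalComplex.homologyFunctorSingleIso (ModuleCat.{u} ℤ) (ComplexShape.up ℤ) 0)

theorem isZero_koszulHomology_of_neg (V : FIModule.{u}) (n : ℕ) (i : ℤ) (hi : i < 0) :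
    IsZero ((koszulHomology n i).obj V) := by
  induction n generalizing V i with
  | zero => exact isZero_koszulHomology_zero V i hi.ne
  | succ n ih =>
    rw [isZero_koszulHomology_succ_iff V n i (i - 1) (by lia)]
    exact ⟨⟨fun _ _ _ => (ih _ i hi).eq_of_src _ _⟩,
      ⟨fun _ _ _ => (ih _ (i - 1) (by lia)).eq_of_tgt _ _⟩⟩

/-- Unwinding the cones, the chains of degree `i` at `[n]` are sums of copies of `V` on sets with `n
- i` elements. -/
theorem isZero_koszulHomology_of_isZero (V : FIModule.{u}) (N : ℤ)
    (hV : ∀ m : ℕ, N ≤ m → IsZero (V.obj (FI.std m))) (n : ℕ) (i : ℤ) (hn : N + i ≤ n) :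
    IsZero ((koszulHomology n i).obj V) := by
  induction n generalizing V i N with
  | zero =>
    by_cases hi : i = 0
    · subst hi
      exact (koszulHomologyZeroIso.app V).isZero_iff.2 (hV 0 (by simpa using hn))
    · exact isZero_koszulHomology_zero V i hi
  | succ n ih =>
    rw [isZero_koszulHomology_succ_iff V n i (i - 1) (by lia)]
    push_cast at hn
    refine ⟨⟨fun _ _ _ => (ih (shift.obj V) (N - 1) (fun m hm => ?_) i
      (by lia)).eq_of_src _ _⟩, ⟨fun _ _ _ => (ih V N hV (i - 1) (by lia)).eq_of_tgt _ _⟩⟩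
    exact hV (m + 1) (by push_cast; lia)

/-- A form of Nakayama's lemma. The vanishing of `H₀` passes from `V` to its shift, and iterated
shifts evaluated on the empty set recover all values of `V`. -/
theorem isZero_obj_std_of_isZero_koszulHomology (V : FIModule.{u})
    (hV : ∀ n, IsZero ((koszulHomology n 0).obj V)) (n : ℕ) : IsZero (V.obj (FI.std n)) := by
  induction n generalizing V with
  | zero => exact (koszulHomologyZeroIso.app V).isZero_iff.1 (hV 0)
  | succ n ih =>
    refine ih (shift.obj V) fun m => ?_
    have := ((isZero_koszulHomology_succ_iff V m 0 (-1) (by lia)).1 (hV (m + 1))).1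
    exact (hV m).of_epi ((koszulHomology m 0).map (toShift.app V))

end FIModule

/-! ### Degree zero Koszul homology is `FIH0`. -/

theorem FI.exists_comp_eq {A B C : FI} (f : A ⟶ B) (g : C ⟶ B)
    (h : ∀ a, ∃ c, FI.emb g c = FI.emb f a) : ∃ k : A ⟶ C, k ≫ g = f := by
  choose k hk using h
  refine ⟨FI.ofEmb ⟨k, fun a b hab => (FI.emb f).injective ?_⟩, FI.hom_ext hk⟩
  rw [← hk, ← hk, hab]

theorem LinearMap.ker_comp_eq_ker_sup_range {R X Y H₀ H H' : Type*} [Ring R] [AddCommGroup X]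
    [AddCommGroup Y] [AddCommGroup H₀] [AddCommGroup H] [AddCommGroup H'] [Module R X] [Module R Y]
    [Module R H₀] [Module R H] [Module R H'] {f : Y →ₗ[R] X} {q : X →ₗ[R] H} {q' : Y →ₗ[R] H₀}
    {g : H₀ →ₗ[R] H} {r : H →ₗ[R] H'} (hq' : Function.Surjective q') (hgr : Function.Exact g r)
    (h : ∀ y, q (f y) = g (q' y)) :
    LinearMap.ker (r ∘ₗ q) = LinearMap.ker q ⊔ LinearMap.range f := by
  ext x
  rw [LinearMap.mem_ker, LinearMap.comp_apply, hgr (q x), Submodule.mem_sup]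
  constructor
  · rintro ⟨z, hz⟩
    obtain ⟨y, rfl⟩ := hq' z
    refine ⟨x - f y, ?_, _, ⟨y, rfl⟩, sub_add_cancel _ _⟩
    rw [LinearMap.mem_ker, map_sub, sub_eq_zero, h, hz]
  · rintro ⟨a, ha, _, ⟨y, rfl⟩, rfl⟩
    rw [LinearMap.mem_ker] at ha
    exact ⟨q' y, by rw [map_add, ha, zero_add, h]⟩

namespace FIModule

theorem range_map_le_of_comp (V : FIModule.{u}) {A B C : FI} (k : A ⟶ C) (g : C ⟶ B) :
    LinearMap.range (V.map (k ≫ g)).hom ≤ LinearMap.range (V.map g).hom := by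
  rw [V.map_comp, ModuleCat.hom_comp]
  exact LinearMap.range_comp_le_range _ _

/-- A proper subset of `T ⊔ {*}` either contains `*`, and then meets `T` in a proper subset, or lies
inside `T`. -/
theorem decomposables_addPoint (V : FIModule.{u}) (T : FI) :
    V.decomposables (FI.addPoint.obj T) =
      (shift.obj V).decomposables T ⊔ LinearMap.range (V.map (FI.toAddPoint.app T)).hom := by
  refine le_antisymm (iSup_le fun U => ?_) (sup_le (iSup_le fun U => ?_) ?_)
  · by_cases hn : (none : Option T.carrier) ∈ U.1
    · let U' : Set T.carrier := {t | some t ∈ U.1}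
      have hU' : U' ≠ Set.univ := fun h => U.2 <| Set.eq_univ_of_forall fun x => by
        cases x with
        | none => exact hn
        | some t =>
          have : t ∈ U' := h ▸ Set.mem_univ t
          exact this
      obtain ⟨k, hk⟩ := FI.exists_comp_eq (FI.incl (S := FI.addPoint.obj T) U.1)
        (FI.addPoint.map (FI.incl U')) (by
          rintro ⟨x, hx⟩
          cases x with
          | none => exact ⟨none, rfl⟩
          | some t => exact ⟨some ⟨t, hx⟩, rfl⟩)
      refine le_trans ?_ le_sup_left
      refine le_trans ?_ (le_iSup (fun T_1 : {T_1 : Set T.carrier // T_1 ≠ Set.univ} =>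
        LinearMap.range ((shift.obj V).map (FI.incl T_1.1)).hom) ⟨U', hU'⟩)
      rw [← hk]
      exact range_map_le_of_comp V k _
    · obtain ⟨k, hk⟩ := FI.exists_comp_eq (FI.incl (S := FI.addPoint.obj T) U.1)
        (FI.toAddPoint.app T) (by
          rintro ⟨x, hx⟩
          cases x with
          | none => exact absurd hx hn
          | some t => exact ⟨t, rfl⟩)
      rw [← hk]
      exact (range_map_le_of_comp V k _).trans le_sup_right
  · rintro _ ⟨x, rfl⟩
    refine V.map_mem_decomposables (FI.addPoint.map (FI.incl U.1)) (fun h => U.2 ?_) x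
    refine Set.eq_univ_of_forall fun t => ?_
    obtain ⟨y, hy⟩ := h (some t)
    cases y with
    | none => cases hy
    | some y => exact Option.some.inj hy ▸ y.2
  · rintro _ ⟨x, rfl⟩
    refine V.map_mem_decomposables _ (fun h => ?_) x
    obtain ⟨y, hy⟩ := h none
    cases hy

/-- The map `H_i(koszul n V_{- ⊔ {*}}) ⟶ H_i(koszul (n + 1) V)`. -/
noncomputable def koszulHomologyInr (n : ℕ) (i : ℤ) :
    shift.{u} ⋙ koszulHomology n i ⟶ koszulHomology (n + 1) i :=
  Functor.whiskerRight (Functor.mappingConeInr (Functor.whiskerRight toShift (koszul n)))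
    (HomologicalComplex.homologyFunctor _ _ (-i))

theorem exact_koszulHomologyInr (V : FIModule.{u}) (n : ℕ) (i : ℤ) :
    ∃ h : (koszulHomology n i).map (toShift.app V) ≫ (koszulHomologyInr n i).app V = 0,
      (ShortComplex.mk _ _ h).Exact :=
  ⟨_, CochainComplex.exact_homologyMap_inr ((koszul n).map (toShift.app V)) (-i)⟩

theorem epi_koszulHomologyInr (V : FIModule.{u}) (n : ℕ) :
    Epi ((koszulHomologyInr n 0).app V) :=
  CochainComplex.epi_homologyMap_inr ((koszul n).map (toShift.app V)) (-0) (- -1) (by simp)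
    (isZero_koszulHomology_of_neg V n (-1) (by simp))

/-- The projection of the value on a standard finite set to the degree zero Koszul homology. -/
noncomputable def toKoszulHomology : ∀ n : ℕ,
    (evaluation FI (ModuleCat.{u} ℤ)).obj (FI.std n) ⟶ koszulHomology.{u} n 0
  | 0 => koszulHomologyZeroIso.inv
  | n + 1 => Functor.whiskerLeft shift (toKoszulHomology n) ≫ koszulHomologyInr n 0

theorem epi_toKoszulHomology (V : FIModule.{u}) (n : ℕ) : Epi ((toKoszulHomology n).app V) := by
  induction n generalizing V with
  | zero =>
    change Epi (koszulHomologyZeroIso.inv.app V)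
    infer_instance
  | succ n ih =>
    have := ih (shift.obj V)
    have := epi_koszulHomologyInr V n
    exact epi_comp ((toKoszulHomology n).app (shift.obj V)) ((koszulHomologyInr n 0).app V)

/-- In degree zero the cone sequence presents the homology at `n + 1` as a cokernel, so the kernel
of the projection grows by the image of `V → ΣV`. This matches the recursion of
`decomposables_addPoint`. -/
theorem ker_toKoszulHomology (V : FIModule.{u}) (n : ℕ) :
    LinearMap.ker ((toKoszulHomology n).app V).hom = V.decomposables (FI.std n) := by
  induction n generalizing V with
  | zero =>
    have h1 : V.decomposables (FI.std 0) = ⊥ :=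
      le_bot_iff.1 (iSup_le fun T => (T.2 (Set.eq_univ_of_forall fun x => Empty.elim x)).elim)
    rw [h1, LinearMap.ker_eq_bot]
    have h2 : IsIso (koszulHomologyZeroIso.{u}.inv.app V) :=
      (koszulHomologyZeroIso.{u}.app V).symm.isIso_hom
    have h2 : Mono (koszulHomologyZeroIso.{u}.inv.app V) := IsIso.mono_of_iso _
    exact (ModuleCat.mono_iff_injective _).1 h2
  | succ n ih =>
    obtain ⟨h, hex⟩ := exact_koszulHomologyInr V n 0
    have hq : ∀ y : V.obj (FI.std n), ((toKoszulHomology n).app (shift.obj V)).hom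
        ((V.map (FI.toAddPoint.app (FI.std n))).hom y) =
        ((koszulHomology n 0).map (toShift.app V)).hom (((toKoszulHomology n).app V).hom y) :=
      fun y => congrArg (fun φ => φ.hom y) ((toKoszulHomology n).naturality (toShift.app V))
    refine Eq.trans ?_ (V.decomposables_addPoint (FI.std n)).symm
    rw [← ih (shift.obj V)]
    exact LinearMap.ker_comp_eq_ker_sup_range
      ((ModuleCat.epi_iff_surjective _).1 (epi_toKoszulHomology V n))
      ((ShortComplex.ShortExact.moduleCat_exact_iff_function_exact _).1 hex) hq

theorem isZero_koszulHomology_iff (V : FIModule.{u}) (n : ℕ) :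
    IsZero ((koszulHomology n 0).obj V) ↔ V.decomposables (FI.std n) = ⊤ := by
  have := epi_toKoszulHomology V n
  rw [← ker_toKoszulHomology, LinearMap.ker_eq_top]
  constructor
  · intro h
    exact ModuleCat.hom_ext_iff.1 (h.eq_of_tgt ((toKoszulHomology n).app V) 0)
  · intro h
    have h' : (toKoszulHomology n).app V = 0 := ModuleCat.hom_ext h
    exact IsZero.of_epi_eq_zero _ h'

theorem isZero_FIH0_obj_iff (V : FIModule.{u}) (S : FB) :
    IsZero ((FIH0.obj V).obj S) ↔ V.decomposables (FB.toFI.obj S) = ⊤ :=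
  ModuleCat.isZero_iff_subsingleton.trans Submodule.Quotient.subsingleton_iff

theorem isZero_FIH0_obj_iff_koszulHomology (V : FIModule.{u}) (S : FB) (n : ℕ)
    (hS : Nat.card S.carrier = n) :
    IsZero ((FIH0.obj V).obj S) ↔ IsZero ((koszulHomology n 0).obj V) := by
  obtain ⟨e⟩ := Finite.card_eq.1 (hS.trans (FI.card_std n).symm)
  let T : FB := ⟨(FI.std n).carrier⟩
  let i : S ≅ T :=
    { hom := FB.ofEquiv e
      inv := FB.ofEquiv (S := T) (T := S) e.symm
      hom_inv_id := FB.hom_ext fun x => e.symm_apply_apply x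
      inv_hom_id := FB.hom_ext fun x => e.apply_symm_apply x }
  rw [((FIH0.obj V).mapIso i).isZero_iff, isZero_FIH0_obj_iff, isZero_koszulHomology_iff]
  rfl

theorem generatedInDegreesLE_iff (V : FIModule.{u}) (g : ℤ) :
    V.GeneratedInDegreesLE g ↔
      -1 ≤ g ∧ ∀ n : ℕ, g < n → IsZero ((koszulHomology n 0).obj V) := by
  refine (FBModule.deg_le_iff _ _).trans (and_congr_right fun _ => ⟨fun h n hn => ?_,
    fun h S hS => ?_⟩)
  · have hc : Nat.card (⟨(FI.std n).carrier⟩ : FB).carrier = n := FI.card_std n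
    rw [← isZero_FIH0_obj_iff_koszulHomology V ⟨(FI.std n).carrier⟩ n hc]
    exact h _ (by rwa [hc])
  · rw [isZero_FIH0_obj_iff_koszulHomology V S _ rfl]
    exact h _ hS

/-- If `V → ΣV` is zero then every inclusion of a proper subset acts as zero, so `V` agrees with its
own `H₀`. -/
theorem isZero_obj_std_of_toShift_eq_zero (V : FIModule.{u}) (hV : toShift.app V = 0) (n : ℕ)
    (h : IsZero ((koszulHomology n 0).obj V)) : IsZero (V.obj (FI.std n)) := by
  rw [isZero_koszulHomology_iff] at h
  have hbot : V.decomposables (FI.std n) = ⊥ := by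
    refine le_bot_iff.1 (iSup_le fun T => ?_)
    obtain ⟨s, hs⟩ := (Set.ne_univ_iff_exists_notMem _).1 T.2
    -- A point `s` outside `T` factors the inclusion through `T → T ⊔ {*}`, with `*` sent to `s`.
    let g : FI.addPoint.obj ⟨T.1⟩ ⟶ FI.std n := FI.ofEmb
      ⟨fun x => x.elim s Subtype.val, by
        rintro (_ | x) (_ | y) hxy
        · rfl
        · exact (hs ((show s = y.1 from hxy) ▸ y.2)).elim
        · exact (hs ((show x.1 = s from hxy) ▸ x.2)).elim
        · exact congrArg some (Subtype.ext hxy)⟩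
    have hg : FI.incl T.1 = FI.toAddPoint.app ⟨T.1⟩ ≫ g := rfl
    have h0 : V.map (FI.toAddPoint.app ⟨T.1⟩) = 0 :=
      congrArg (fun φ : V ⟶ shift.obj V => φ.app ⟨T.1⟩) hV
    rw [hg, V.map_comp, h0, zero_comp]
    rintro _ ⟨x, rfl⟩
    rfl
  rw [hbot] at h
  exact ModuleCat.isZero_iff_subsingleton.2 ((Submodule.subsingleton_iff ℤ).1
    (subsingleton_of_bot_eq_top h))

end FIModule

/-! ### Kernel, image and cokernel of `V → ΣV`. -/

section Abelian

variable {A : Type*} [Category* A] [Abelian A] {X Y : A} (f : X ⟶ Y)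

theorem CategoryTheory.Abelian.shortExact_kernel_image :
    (ShortComplex.mk (kernel.ι f) (Abelian.factorThruImage f) (by
      rw [← cancel_mono (Abelian.image.ι f), Category.assoc, Abelian.image.fac,
        kernel.condition, zero_comp])).ShortExact where
  exact := by
    let φ : ShortComplex.mk (kernel.ι f) (Abelian.factorThruImage f) (by
      rw [← cancel_mono (Abelian.image.ι f), Category.assoc, Abelian.image.fac,
        kernel.condition, zero_comp]) ⟶ ShortComplex.mk (kernel.ι f) f (kernel.condition f) :=
      { τ₁ := 𝟙 _, τ₂ := 𝟙 _, τ₃ := Abelian.image.ι f }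
    have : Epi φ.τ₁ := inferInstanceAs (Epi (𝟙 _))
    have : IsIso φ.τ₂ := inferInstanceAs (IsIso (𝟙 _))
    have : Mono φ.τ₃ := inferInstanceAs (Mono (Abelian.image.ι f))
    exact (ShortComplex.exact_iff_of_epi_of_isIso_of_mono φ).2
      (ShortComplex.exact_of_f_is_kernel _ (kernelIsKernel f))
  mono_f := inferInstanceAs (Mono (kernel.ι f))
  epi_g := inferInstanceAs (Epi (Abelian.factorThruImage f))

theorem CategoryTheory.Abelian.shortExact_image_cokernel :
    (ShortComplex.mk (Abelian.image.ι f) (cokernel.π f)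
      (kernel.condition (cokernel.π f))).ShortExact where
  exact := ShortComplex.exact_of_f_is_kernel _ (kernelIsKernel (cokernel.π f))
  mono_f := inferInstanceAs (Mono (kernel.ι (cokernel.π f)))
  epi_g := inferInstanceAs (Epi (cokernel.π f))

end Abelian

namespace FIModule

section Sequence

variable {S : ShortComplex FIModule.{u}} (hS : S.ShortExact) (n : ℕ)

include hS

theorem isZero_koszulHomology_X₃ (i j : ℤ) (hij : i = j + 1)
    (h₁ : Epi ((koszulHomology n i).map S.f))
    (h₂ : Mono ((koszulHomology n j).map S.f)) :
    IsZero ((koszulHomology n i).obj S.X₃) := by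
  obtain ⟨δ, _, h, hδ, -⟩ := exists_connecting hS n i j hij
  have hg : (koszulHomology n i).map S.g = 0 :=
    (exact_map_koszulHomology hS n i).epi_f_iff.1 h₁
  have : Mono δ := hδ.mono_g_iff.2 hg
  have h0 : δ = 0 := by rwa [← cancel_mono ((koszulHomology n j).map S.f), zero_comp]
  exact IsZero.of_mono_eq_zero δ h0

theorem epi_map_f (i : ℤ) (h : IsZero ((koszulHomology n i).obj S.X₃)) :
    Epi ((koszulHomology n i).map S.f) :=
  (exact_map_koszulHomology hS n i).epi_f_iff.2 (h.eq_of_tgt _ _)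

theorem mono_map_f_of_epi_map_g (i j : ℤ) (hij : i = j + 1)
    (h : Epi ((koszulHomology n i).map S.g)) :
    Mono ((koszulHomology n j).map S.f) := by
  obtain ⟨δ, _, _, h₁, h₂⟩ := exists_connecting hS n i j hij
  exact h₂.mono_g_iff.2 (h₁.epi_f_iff.1 h)

theorem mono_map_f (i j : ℤ) (hij : i = j + 1)
    (h : IsZero ((koszulHomology n i).obj S.X₃)) :
    Mono ((koszulHomology n j).map S.f) :=
  mono_map_f_of_epi_map_g hS n i j hij ⟨fun _ _ _ => h.eq_of_src _ _⟩

theorem epi_map_g (i j : ℤ) (hij : i = j + 1)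
    (h : IsZero ((koszulHomology n j).obj S.X₁)) :
    Epi ((koszulHomology n i).map S.g) := by
  obtain ⟨δ, _, _, h₁, h₂⟩ := exists_connecting hS n i j hij
  exact h₁.epi_f_iff.2 (h.eq_of_tgt _ _)

theorem epi_koszulHomology_zero_map_g : Epi ((koszulHomology n 0).map S.g) :=
  epi_map_g hS n 0 (-1) (by simp) (isZero_koszulHomology_of_neg _ n _ (by simp))

end Sequence

section Shift

variable (V : FIModule.{u}) (n : ℕ)

theorem map_factorThruImage_comp (i : ℤ) {W : FIModule.{u}} (φ : V ⟶ W) :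
    (koszulHomology n i).map (Abelian.factorThruImage φ) ≫
      (koszulHomology n i).map (Abelian.image.ι φ) = (koszulHomology n i).map φ := by
  rw [← Functor.map_comp, Abelian.image.fac]

/-- The derivative of an `FI`-module is the cokernel of `V ⟶ V_{- ⊔ {*}}`. -/
noncomputable abbrev derivative : FIModule.{u} := cokernel (toShift.app V)

theorem epi_map_image_ι (i : ℤ) (h : IsZero ((koszulHomology (n + 1) i).obj V)) :
    Epi ((koszulHomology n i).map (Abelian.image.ι (toShift.app V))) := by
  have h' := ((isZero_koszulHomology_succ_iff V n i (i - 1) (by lia)).1 h).1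
  rw [← map_factorThruImage_comp] at h'
  exact epi_of_epi ((koszulHomology n i).map (Abelian.factorThruImage (toShift.app V))) _

theorem mono_map_factorThruImage (h : IsZero ((koszulHomology (n + 1) 1).obj V)) :
    Mono ((koszulHomology n 0).map (Abelian.factorThruImage (toShift.app V))) := by
  have h' := ((isZero_koszulHomology_succ_iff V n 1 0 (by lia)).1 h).2
  rw [← map_factorThruImage_comp] at h'
  exact mono_of_mono _ ((koszulHomology n 0).map (Abelian.image.ι (toShift.app V)))

/-- On `H₀` the map from `V` to the image is always epi, and here also mono. It is thus an
isomorphism, and can be cancelled from the mono `H₀(V) → H₀(ΣV)`. -/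
theorem mono_map_image_ι (h : IsZero ((koszulHomology (n + 1) 1).obj V)) :
    Mono ((koszulHomology n 0).map (Abelian.image.ι (toShift.app V))) := by
  have h' := ((isZero_koszulHomology_succ_iff V n 1 0 (by lia)).1 h).2
  have h₁ := mono_map_factorThruImage V n h
  have h₂ : Epi ((koszulHomology n 0).map (Abelian.factorThruImage (toShift.app V))) :=
    epi_koszulHomology_zero_map_g (Abelian.shortExact_kernel_image (toShift.app V)) n
  have := isIso_of_mono_of_epi
    ((koszulHomology n 0).map (Abelian.factorThruImage (toShift.app V)))
  rw [← map_factorThruImage_comp] at h'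
  exact (MorphismProperty.cancel_left_of_respectsIso (.monomorphisms _) _ _).1 h'

theorem isZero_koszulHomology_zero_derivative (h : IsZero ((koszulHomology (n + 1) 0).obj V)) :
    IsZero ((koszulHomology n 0).obj (derivative V)) :=
  isZero_koszulHomology_X₃ (Abelian.shortExact_image_cokernel (toShift.app V)) n 0 (-1) (by simp)
    (epi_map_image_ι V n _ h)
    ⟨fun _ _ _ => (isZero_koszulHomology_of_neg _ n (-1) (by simp)).eq_of_tgt _ _⟩

theorem isZero_koszulHomology_one_derivative (h : IsZero ((koszulHomology (n + 1) 1).obj V)) :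
    IsZero ((koszulHomology n 1).obj (derivative V)) :=
  isZero_koszulHomology_X₃ (Abelian.shortExact_image_cokernel (toShift.app V)) n 1 0 (by simp)
    (epi_map_image_ι V n _ h) (mono_map_image_ι V n h)

/-- By naturality the map becomes zero after embedding into `ΣV`, and the shift preserves
monomorphisms. -/
theorem toShift_kernel : toShift.app (kernel (toShift.app V)) = 0 := by
  have h := shortExact_map_shift (Abelian.shortExact_kernel_image (toShift.app V))
  have : Mono (shift.map (kernel.ι (toShift.app V))) := h.mono_f
  rw [← cancel_mono (shift.map (kernel.ι (toShift.app V))), zero_comp]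
  exact (toShift.naturality (kernel.ι (toShift.app V))).symm.trans (kernel.condition _)

/-- With `K` the kernel and `I` the image, `H₀(K) → H₀(V)` is both mono and zero at `[n]`. It is
mono because `H₁(V) → H₁(I)` is epi, and zero because `H₀(V) → H₀(I)` is mono. So `H₀(K)` vanishes
at `[n]`, and for `K` this is the value itself. -/
theorem isZero_kernel_obj_std (h₁ : IsZero ((koszulHomology (n + 1) 1).obj V))
    (h₂ : IsZero ((koszulHomology n 2).obj (derivative V))) :
    IsZero ((kernel (toShift.app V)).obj (FI.std n)) := by
  have hm : Mono ((koszulHomology n 1).map (Abelian.image.ι (toShift.app V))) :=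
    mono_map_f (Abelian.shortExact_image_cokernel (toShift.app V)) n 2 1 (by simp) h₂
  have he : Epi ((koszulHomology n 1).map (Abelian.factorThruImage (toShift.app V))) := by
    have h' := ((isZero_koszulHomology_succ_iff V n 1 0 (by lia)).1 h₁).1
    have := epi_map_image_ι V n 1 h₁
    have := isIso_of_mono_of_epi
      ((koszulHomology n 1).map (Abelian.image.ι (toShift.app V)))
    rw [← map_factorThruImage_comp] at h'
    exact (MorphismProperty.cancel_right_of_respectsIso (.epimorphisms _) _ _).1 h'
  have hS := Abelian.shortExact_kernel_image (toShift.app V)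
  have hk : Mono ((koszulHomology n 0).map (kernel.ι (toShift.app V))) :=
    mono_map_f_of_epi_map_g hS n 1 0 (by simp) he
  have hk0 : (koszulHomology n 0).map (kernel.ι (toShift.app V)) = 0 :=
    (exact_map_koszulHomology hS n 0).mono_g_iff.1 (mono_map_factorThruImage V n h₁)
  exact isZero_obj_std_of_toShift_eq_zero _ (toShift_kernel V) n (IsZero.of_mono_eq_zero _ hk0)

theorem isZero_koszulHomology_two_succ
    (hK : IsZero ((koszulHomology n 1).obj (kernel (toShift.app V))))
    (hD : IsZero ((koszulHomology n 2).obj (derivative V)))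
    (hV : IsZero ((koszulHomology n 1).obj V)) :
    IsZero ((koszulHomology (n + 1) 2).obj V) := by
  rw [isZero_koszulHomology_succ_iff V n 2 1 (by lia), ← map_factorThruImage_comp]
  have h₁ : Epi ((koszulHomology n 2).map (Abelian.factorThruImage (toShift.app V))) :=
    epi_map_g (Abelian.shortExact_kernel_image (toShift.app V)) n 2 1 (by simp) hK
  have h₂ : Epi ((koszulHomology n 2).map (Abelian.image.ι (toShift.app V))) :=
    epi_map_f (Abelian.shortExact_image_cokernel (toShift.app V)) n 2 hD
  exact ⟨epi_comp _ _, ⟨fun _ _ _ => hV.eq_of_tgt _ _⟩⟩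

end Shift

/-! ### Bounds for the second homology. -/

/-- The inductive step of both bounds. The kernel of `V → ΣV` vanishes from size `m` on, so its `H₁`
vanishes from `m + 1` on; one more unit comes from passing from `n` to `n + 1`. -/
theorem isZero_koszulHomology_two_of_derivative (V : FIModule.{u}) (d m : ℤ) (hdm : d ≤ m)
    (h₁ : ∀ n : ℕ, d < n → IsZero ((koszulHomology n 1).obj V))
    (h₂ : ∀ n : ℕ, m ≤ n → IsZero ((koszulHomology n 2).obj (derivative V)))
    (n : ℕ) (hn : m + 1 < n) : IsZero ((koszulHomology n 2).obj V) := by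
  cases n with
  | zero => exact isZero_koszulHomology_zero V 2 (by simp)
  | succ n =>
    push_cast at hn
    refine isZero_koszulHomology_two_succ V n ?_ (h₂ n (by lia)) (h₁ n (by lia))
    refine isZero_koszulHomology_of_isZero _ m (fun l hl => ?_) n 1 (by lia)
    exact isZero_kernel_obj_std V l (h₁ _ (by push_cast; lia)) (h₂ l hl)

/-- An `FI`-module generated in degrees `< k` with relations in degrees `≤ d` has its second
homology in degrees `≤ k + d`. -/
theorem isZero_koszulHomology_two_of_lt_add (k : ℕ) (d : ℤ) (V : FIModule.{u})
    (h₀ : ∀ n : ℕ, k ≤ n → IsZero ((koszulHomology n 0).obj V))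
    (h₁ : ∀ n : ℕ, d < n → IsZero ((koszulHomology n 1).obj V)) (n : ℕ) (hn : k + d < n) :
    IsZero ((koszulHomology n 2).obj V) := by
  induction k generalizing d V n with
  | zero =>
    have hV := isZero_obj_std_of_isZero_koszulHomology V fun n => h₀ n n.zero_le
    -- Since `V` vanishes everywhere, the bound `-2` is allowed, and it covers every `n ≥ 0` in
    -- homological degree 2.
    exact isZero_koszulHomology_of_isZero V (-2) (fun m _ => hV m) n 2 (by lia)
  | succ k ih =>
    push_cast at hn
    refine isZero_koszulHomology_two_of_derivative V d (k + d) (by lia) h₁ (fun m hm => ?_) n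
      (by lia)
    -- The relation bound `d` is an integer, so it can drop below zero as derivatives are taken.
    refine ih (d - 1) (derivative V) (fun l hl => ?_) (fun l hl => ?_) m (by lia)
    · exact isZero_koszulHomology_zero_derivative V l (h₀ (l + 1) (by lia))
    · exact isZero_koszulHomology_one_derivative V l (h₁ (l + 1) (by push_cast; lia))

/-- An `FI`-module generated in finite degree with relations in degrees `≤ d` has its second
homology in degrees `≤ 2 * d`. -/
theorem isZero_koszulHomology_two_of_lt_two_mul (k d : ℕ) (V : FIModule.{u})
    (h₀ : ∀ n : ℕ, k ≤ n → IsZero ((koszulHomology n 0).obj V))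
    (h₁ : ∀ n : ℕ, d < n → IsZero ((koszulHomology n 1).obj V)) (n : ℕ) (hn : 2 * d < n) :
    IsZero ((koszulHomology n 2).obj V) := by
  have acyclic (k : ℕ) (V : FIModule.{u})
      (h₀ : ∀ n : ℕ, k ≤ n → IsZero ((koszulHomology n 0).obj V))
      (h₁ : ∀ n : ℕ, 0 < n → IsZero ((koszulHomology n 1).obj V)) (n : ℕ) :
      IsZero ((koszulHomology n 2).obj V) := by
    -- With `d = -k - 1` the bound `k + d` is `-1`, so the conclusion holds in all degrees. At `n =
    -- 0` the first homology vanishes for any `V`.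
    refine isZero_koszulHomology_two_of_lt_add k (-k - 1) V h₀ (fun n _ => ?_) n (by lia)
    rcases n.eq_zero_or_pos with rfl | hn
    · exact isZero_koszulHomology_zero V 1 (by simp)
    · exact h₁ n hn
  induction k generalizing d V n with
  | zero =>
    have hV := isZero_obj_std_of_isZero_koszulHomology V fun n => h₀ n n.zero_le
    exact isZero_koszulHomology_of_isZero V (-2) (fun m _ => hV m) n 2 (by lia)
  | succ k ih =>
    rcases d with _ | d
    · exact acyclic (k + 1) V h₀ h₁ n
    -- By induction `H₂` of the derivative lives in degrees `≤ 2 * d`, hence vanishes from `2 * d +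
    -- 1` on, and the step yields the bound `2 * (d + 1)`.
    refine isZero_koszulHomology_two_of_derivative V (d + 1) (2 * d + 1) (by lia)
      (fun m hm => h₁ m (by lia)) (fun m hm => ?_) n (by lia)
    refine ih d (derivative V) (fun l hl => ?_) (fun l hl => ?_) m (by lia)
    · exact isZero_koszulHomology_zero_derivative V l (h₀ (l + 1) (by lia))
    · exact isZero_koszulHomology_one_derivative V l (h₁ (l + 1) (by lia))

end FIModule

/-! ### Projective modules have no first Koszul homology. -/

namespace FIModule

/-- The `FI`-module freely generated by a functor from `FI` to types. -/
noncomputable def linearize (E : FI ⥤ Type u) : FIModule.{u} where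
  obj S := ModuleCat.of ℤ (E.obj S →₀ ℤ)
  map f := ModuleCat.ofHom (Finsupp.lmapDomain ℤ ℤ (E.map f))
  map_id S := by
    ext : 1
    refine Finsupp.lhom_ext' fun a => LinearMap.ext_ring ?_
    simp
  map_comp f g := by
    ext : 1
    refine Finsupp.lhom_ext' fun a => LinearMap.ext_ring ?_
    simp

theorem linearize_map_single (E : FI ⥤ Type u) {S T : FI} (f : S ⟶ T) (x : E.obj S) :
    ((linearize E).map f).hom (Finsupp.single x (1 : ℤ)) = Finsupp.single (E.map f x) (1 : ℤ) :=
  Finsupp.mapDomain_single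

/-- A functor from `FI` to types preserves intersections if it sends squares of injections that
exhibit an intersection to squares with the corresponding lifting property. -/
def PreservesIntersections (E : FI ⥤ Type u) : Prop :=
  ∀ ⦃P S T U : FI⦄ (a : P ⟶ S) (b : P ⟶ T) (c : S ⟶ U) (d : T ⟶ U),
    (∀ s t, FI.emb c s = FI.emb d t → ∃ p, FI.emb a p = s ∧ FI.emb b p = t) →
    ∀ (x : E.obj S) (y : E.obj T), E.map c x = E.map d y → ∃ z, E.map a z = x ∧ E.map b z = y

namespace PreservesIntersections

variable {E : FI ⥤ Type u} (hE : PreservesIntersections E)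

include hE

theorem map_injective {S T : FI} (f : S ⟶ T) : Function.Injective (E.map f) := fun x y h => by
  obtain ⟨z, rfl, rfl⟩ := hE (𝟙 S) (𝟙 S) f f
    (fun s t hst => ⟨s, rfl, (FI.emb f).injective hst⟩) x y h
  rfl

theorem addPoint : PreservesIntersections (FI.addPoint ⋙ E) := by
  intro P S T U a b c d h x y hxy
  refine hE (FI.addPoint.map a) (FI.addPoint.map b) (FI.addPoint.map c) (FI.addPoint.map d) ?_
    x y hxy
  rintro (_ | s) (_ | t) hst
  · exact ⟨none, rfl, rfl⟩
  · cases hst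
  · cases hst
  · obtain ⟨p, rfl, rfl⟩ := h s t (Option.some.inj hst)
    exact ⟨some p, rfl, rfl⟩

theorem mem_range {S T : FI} (f : S ⟶ T) (x : E.obj (FI.addPoint.obj S))
    (h : E.map (FI.addPoint.map f) x ∈ Set.range (E.map (FI.toAddPoint.app T))) :
    x ∈ Set.range (E.map (FI.toAddPoint.app S)) := by
  obtain ⟨y, hy⟩ := h
  obtain ⟨z, hz, -⟩ := hE (FI.toAddPoint.app S) f (FI.addPoint.map f) (FI.toAddPoint.app T) (by
    rintro (_ | s) t hst
    · cases hst
    · exact ⟨s, rfl, Option.some.inj hst⟩) x y hy.symm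
  exact ⟨z, hz⟩

-- The retraction sends a basis element to its preimage in `E(S)` if there is one and to zero
-- otherwise. Naturality requires that an element outside `E(S)` stay outside `E(T)`, which is
-- `mem_range`, the intersection property for `S = T ∩ (S ⊔ {*})`.
open Classical in
theorem exists_retraction : ∃ r : shift.obj (linearize E) ⟶ linearize E,
    toShift.app (linearize E) ≫ r = 𝟙 _ := by
  let ρ (S : FI) : (E.obj (FI.addPoint.obj S) →₀ ℤ) →ₗ[ℤ] (E.obj S →₀ ℤ) :=
    Finsupp.linearCombination ℤ fun x =>
      if h : ∃ y, E.map (FI.toAddPoint.app S) y = x then Finsupp.single h.choose (1 : ℤ) else 0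
  have hρ (S : FI) (y : E.obj S) :
      ρ S (Finsupp.single (E.map (FI.toAddPoint.app S) y) 1) = Finsupp.single y 1 := by
    have h : ∃ y', E.map (FI.toAddPoint.app S) y' = E.map (FI.toAddPoint.app S) y := ⟨y, rfl⟩
    simp only [ρ, Finsupp.linearCombination_single, one_smul, dif_pos h]
    rw [hE.map_injective _ h.choose_spec]
  have hρ' (S : FI) (x : E.obj (FI.addPoint.obj S))
      (hx : x ∉ Set.range (E.map (FI.toAddPoint.app S))) : ρ S (Finsupp.single x 1) = 0 := by
    simp only [ρ, Finsupp.linearCombination_single, one_smul]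
    exact dif_neg hx
  have hnat {S T : FI} (f : S ⟶ T) (y : E.obj S) : E.map (FI.addPoint.map f)
      (E.map (FI.toAddPoint.app S) y) = E.map (FI.toAddPoint.app T) (E.map f y) := by
    rw [← ConcreteCategory.comp_apply, ← ConcreteCategory.comp_apply, ← E.map_comp, ← E.map_comp]
    exact congrArg (fun φ => E.map φ y) (FI.toAddPoint.naturality f).symm
  refine ⟨{ app := fun S => ModuleCat.ofHom (ρ S), naturality := fun S T f => ?_ }, ?_⟩
  · refine ModuleCat.hom_ext (Finsupp.lhom_ext' fun x => LinearMap.ext_ring ?_)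
    change ρ T (((linearize E).map (FI.addPoint.map f)).hom (Finsupp.single x 1)) =
      ((linearize E).map f).hom (ρ S (Finsupp.single x 1))
    rw [linearize_map_single]
    by_cases hx : x ∈ Set.range (E.map (FI.toAddPoint.app S))
    · obtain ⟨y, rfl⟩ := hx
      rw [hρ, hnat, hρ, linearize_map_single]
    · rw [hρ' S x hx, hρ' T _ fun h => hx (hE.mem_range f x h)]
      exact (((linearize E).map f).hom.map_zero).symm
  · refine NatTrans.ext (funext fun S => ModuleCat.hom_ext
      (Finsupp.lhom_ext' fun x => LinearMap.ext_ring ?_))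
    change ρ S (((linearize E).map (FI.toAddPoint.app S)).hom (Finsupp.single x 1)) =
      Finsupp.single x 1
    rw [linearize_map_single, hρ]

/-- The split injection `V → ΣV` induces monos on `H₀`, and `ΣV` is again the linearization of a
functor preserving intersections, so the induction closes up. -/
theorem isZero_koszulHomology_one (n : ℕ) :
    IsZero ((koszulHomology n 1).obj (linearize E)) := by
  induction n generalizing E with
  | zero => exact isZero_koszulHomology_zero _ 1 (by simp)
  | succ n ih =>
    obtain ⟨r, hr⟩ := hE.exists_retraction
    rw [isZero_koszulHomology_succ_iff _ n 1 0 (by lia)]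
    have h := ih hE.addPoint
    refine ⟨⟨fun _ _ _ => h.eq_of_src _ _⟩, ?_⟩
    have : (koszulHomology n 0).map (toShift.app (linearize E)) ≫ (koszulHomology n 0).map r =
        𝟙 _ := by rw [← Functor.map_comp, hr, CategoryTheory.Functor.map_id]
    exact mono_of_mono_fac this

end PreservesIntersections

/-- The functor sending `S` to the set of pairs of an element of `V_{[n]}` and an injection
`[n] ⟶ S`. -/
def coverBasis (V : FIModule.{u}) : FI ⥤ Type u where
  obj S := Σ n : ℕ, V.obj (FI.std n) × (FI.std n ⟶ S)
  map f := ↾fun x => ⟨x.1, x.2.1, x.2.2 ≫ f⟩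

theorem preservesIntersections_coverBasis (V : FIModule.{u}) :
    PreservesIntersections V.coverBasis := by
  rintro P S T U a b c d h ⟨n, v, k⟩ ⟨n', v', k'⟩ hxy
  change (⟨n, v, k ≫ c⟩ : Σ n : ℕ, V.obj (FI.std n) × (FI.std n ⟶ U)) =
    ⟨n', v', k' ≫ d⟩ at hxy
  obtain rfl : n = n' := congrArg Sigma.fst hxy
  obtain ⟨rfl, hk⟩ := Prod.mk.inj (eq_of_heq (Sigma.mk.inj hxy).2)
  choose l hl hl' using fun t => h (FI.emb k t) (FI.emb k' t)
    (congrArg (fun φ => FI.emb φ t) hk)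
  let m : FI.std n ⟶ P := FI.ofEmb
    ⟨l, fun s t hst => (FI.emb k).injective (by rw [← hl, ← hl, hst])⟩
  refine ⟨⟨n, v, m⟩, ?_, ?_⟩
  · exact congrArg (fun φ => (⟨n, v, φ⟩ : Σ n : ℕ, V.obj (FI.std n) × (FI.std n ⟶ S)))
      (FI.hom_ext hl : m ≫ a = k)
  · exact congrArg (fun φ => (⟨n, v, φ⟩ : Σ n : ℕ, V.obj (FI.std n) × (FI.std n ⟶ T)))
      (FI.hom_ext hl' : m ≫ b = k')

theorem exists_epi_linearize_coverBasis (V : FIModule.{u}) :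
    ∃ π : linearize V.coverBasis ⟶ V, Epi π := by
  let ρ (S : FI) : (V.coverBasis.obj S →₀ ℤ) →ₗ[ℤ] V.obj S :=
    Finsupp.linearCombination ℤ
      fun x : Σ n : ℕ, V.obj (FI.std n) × (FI.std n ⟶ S) => (V.map x.2.2).hom x.2.1
  have hρ (S : FI) (x : Σ n : ℕ, V.obj (FI.std n) × (FI.std n ⟶ S)) :
      ρ S (Finsupp.single x 1) = (V.map x.2.2).hom x.2.1 :=
    (Finsupp.linearCombination_single ℤ (1 : ℤ) x).trans
      (@one_smul ℤ (V.obj S) _ (V.obj S).isModule.toMulAction _)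
  refine ⟨{ app := fun S => ModuleCat.ofHom (ρ S), naturality := fun S T f => ?_ }, ?_⟩
  · refine ModuleCat.hom_ext (Finsupp.lhom_ext' fun x => LinearMap.ext_ring ?_)
    refine (congrArg (ρ T) (linearize_map_single V.coverBasis f x)).trans ((hρ T _).trans
      (Eq.trans ?_ (congrArg (V.map f).hom (hρ S x)).symm))
    rw [← LinearMap.comp_apply, ← ModuleCat.hom_comp, ← V.map_comp]
    rfl
  · rw [NatTrans.epi_iff_epi_app]
    intro S
    rw [ModuleCat.epi_iff_surjective]
    intro x
    obtain ⟨e⟩ := Finite.card_eq.1 (FI.card_std (Nat.card S.carrier))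
    let i : FI.std (Nat.card S.carrier) ⟶ S := FI.ofEmb e.toEmbedding
    let j : S ⟶ FI.std (Nat.card S.carrier) := FI.ofEmb e.symm.toEmbedding
    have hij : j ≫ i = 𝟙 S := FI.hom_ext fun s => e.apply_symm_apply s
    refine ⟨Finsupp.single ⟨_, (V.map j).hom x, i⟩ 1, (hρ S _).trans ?_⟩
    change (V.map i).hom ((V.map j).hom x) = x
    rw [← LinearMap.comp_apply, ← ModuleCat.hom_comp, ← V.map_comp, hij, V.map_id]
    rfl

theorem isZero_koszulHomology_one_of_projective (P : FIModule.{u}) [Projective P] (n : ℕ) :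
    IsZero ((koszulHomology n 1).obj P) := by
  obtain ⟨π, hπ⟩ := exists_epi_linearize_coverBasis P
  have h := (preservesIntersections_coverBasis P).isZero_koszulHomology_one n
  have hs : Projective.factorThru (𝟙 P) π ≫ π = 𝟙 P := Projective.factorThru_comp _ _
  rw [IsZero.iff_id_eq_zero, ← CategoryTheory.Functor.map_id, ← hs, Functor.map_comp]
  rw [h.eq_of_src ((koszulHomology n 1).map π) 0, comp_zero]

end FIModule

/-! ### Comparison with the derived functors, and kernels of maps. -/

theorem CategoryTheory.Abelian.mono_of_exact_comp {A : Type*} [Category* A] [Abelian A]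
    {X Y Z W : A} (d : X ⟶ Y) (e : Y ⟶ Z) (m : Z ⟶ W) (f : Y ⟶ W) [Epi e] (h : d ≫ e = 0)
    (h' : d ≫ f = 0) (hf : f = e ≫ m) (hex : (ShortComplex.mk d f h').Exact) : Mono m := by
  refine Preadditive.mono_of_cancel_zero _ fun {T} a ha => ?_
  obtain ⟨T', π, _, y, hy⟩ := surjective_up_to_refinements_of_epi e a
  obtain ⟨T'', π', _, x, hx⟩ := hex.exact_up_to_refinements y (by
    change y ≫ f = 0
    rw [hf, ← Category.assoc, ← hy, Category.assoc, ha, comp_zero])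
  change π' ≫ y = x ≫ d at hx
  rw [← cancel_epi π, ← cancel_epi π', hy, reassoc_of% hx, h]
  simp

namespace FIModule

theorem mono_koszulHomology_map {V W : FIModule.{u}} (φ : V ⟶ W) [Mono (FIH0.map φ)] (n : ℕ) :
    Mono ((koszulHomology n 0).map φ) := by
  have hm : Mono ((FIH0.map φ).app ⟨(FI.std n).carrier⟩) :=
    (NatTrans.mono_iff_mono_app _).1 inferInstance _
  have hm := (ModuleCat.mono_iff_injective _).1 hm
  rw [ModuleCat.mono_iff_injective]
  refine (injective_iff_map_eq_zero ((koszulHomology n 0).map φ).hom).2 fun z hz => ?_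
  obtain ⟨x, rfl⟩ := (ModuleCat.epi_iff_surjective _).1 (epi_toKoszulHomology V n) z
  have h1 : ((toKoszulHomology n).app W).hom ((φ.app (FI.std n)).hom x) = 0 :=
    (congrArg (fun ψ => ψ.hom x) ((toKoszulHomology n).naturality φ)).trans hz
  rw [← LinearMap.mem_ker, ker_toKoszulHomology] at h1
  have h2 : ((FIH0.map φ).app ⟨(FI.std n).carrier⟩).hom (Submodule.Quotient.mk x) = 0 :=
    (Submodule.Quotient.mk_eq_zero _).2 h1
  have h3 : (Submodule.Quotient.mk x : V.obj (FI.std n) ⧸ V.decomposables (FI.std n)) = 0 :=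
    (injective_iff_map_eq_zero ((FIH0.map φ).app ⟨(FI.std n).carrier⟩).hom).1 hm _ h2
  rw [Submodule.Quotient.mk_eq_zero, ← ker_toKoszulHomology] at h3
  exact h3

theorem shortExact_kernel {V W : FIModule.{u}} (π : V ⟶ W) [Epi π] :
    (ShortComplex.mk (kernel.ι π) π (kernel.condition π)).ShortExact where
  exact := ShortComplex.exact_of_f_is_kernel _ (kernelIsKernel π)
  mono_f := inferInstanceAs (Mono (kernel.ι π))
  epi_g := inferInstanceAs (Epi π)

theorem epi_koszulHomology_map {V W : FIModule.{u}} (π : V ⟶ W) [Epi π] (n : ℕ) :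
    Epi ((koszulHomology n 0).map π) :=
  epi_koszulHomology_zero_map_g (shortExact_kernel π) n

/-- Dimension shifting. For a projective cover `P₀ → V` with kernel `R`, both kinds of first
homology are controlled by whether `H₀(R) → H₀(P₀)` is mono. -/
theorem isZero_koszulHomology_one_of_isZero_FIHomology (V : FIModule.{u})
    (hV : IsZero ((FIHomology 1).obj V)) (n : ℕ) : IsZero ((koszulHomology n 1).obj V) := by
  let P := ProjectiveResolution.of V
  let π : P.complex.X 0 ⟶ V := P.π.f 0
  have : Epi π := inferInstanceAs (Epi (P.π.f 0))
  have hπ : P.complex.d 1 0 ≫ π = 0 := P.complex_d_comp_π_f_zero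
  have hex : (ShortComplex.mk (P.complex.d 1 0) π hπ).Exact := P.exact₀
  have : Epi (kernel.lift π _ hπ) := hex.epi_kernelLift
  have := FIH0Adjunction.{u}.isLeftAdjoint
  have hR : Mono (FIH0.map (kernel.ι π)) := by
    have h1 : ((FIH0.mapHomologicalComplex (ComplexShape.down ℕ)).obj P.complex).ExactAt 1 :=
      (HomologicalComplex.exactAt_iff_isZero_homology _ _).2
        ((P.isoLeftDerivedObj FIH0 1).isZero_iff.1 hV)
    rw [HomologicalComplex.exactAt_iff' _ 2 1 0 (by simp) (by simp)] at h1
    have hd : FIH0.map (P.complex.d 1 0) =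
        FIH0.map (kernel.lift π _ hπ) ≫ FIH0.map (kernel.ι π) := by
      rw [← Functor.map_comp, kernel.lift_ι]
    have h0 : P.complex.d 2 1 ≫ kernel.lift π _ hπ = 0 := by
      rw [← cancel_mono (kernel.ι π), Category.assoc, kernel.lift_ι, P.complex.d_comp_d, zero_comp]
    have hd₂ : FIH0.map (P.complex.d 2 1) ≫ FIH0.map (kernel.lift π _ hπ) = 0 := by
      rw [← Functor.map_comp, h0, Functor.map_zero]
    -- `FIH0`, being a left adjoint, keeps `P₁ → R` epi; exactness at `FIH0(P₁)` then makes `FIH0(R)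
    -- → FIH0(P₀)` mono.
    exact Abelian.mono_of_exact_comp _ _ _ _ hd₂ _ hd h1
  exact isZero_koszulHomology_X₃ (shortExact_kernel π) n 1 0 (by simp)
    ⟨fun _ _ _ => (isZero_koszulHomology_one_of_projective (P.complex.X 0) n).eq_of_src _ _⟩
    (mono_koszulHomology_map _ n)

/-- A bound for the generation degree of the kernel of a map of `H₀`-acyclic `FI`-modules. -/
theorem isZero_koszulHomology_zero_kernel {V W : FIModule.{u}} (f : V ⟶ W) (a N : ℤ)
    (haN : a ≤ N) (hV : ∀ n : ℕ, a < n → IsZero ((koszulHomology n 0).obj V))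
    (hW₁ : ∀ n, IsZero ((koszulHomology n 1).obj W))
    (hQ : (∀ n : ℕ, a < n → IsZero ((koszulHomology n 1).obj (cokernel f))) →
      ∀ n : ℕ, N < n → IsZero ((koszulHomology n 2).obj (cokernel f)))
    (n : ℕ) (hn : N < n) : IsZero ((koszulHomology n 0).obj (kernel f)) := by
  have hS := Abelian.shortExact_kernel_image f
  have hS' := Abelian.shortExact_image_cokernel f
  -- `H₁` of the cokernel embeds in `H₀` of the image, which is a quotient of `H₀(V)`.
  have hQ₂ := hQ (fun m hm => by
    have := epi_koszulHomology_map (Abelian.factorThruImage f) m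
    have hI := (hV m hm).of_epi ((koszulHomology m 0).map (Abelian.factorThruImage f))
    exact isZero_koszulHomology_X₃ hS' m 1 0 (by simp)
      ⟨fun _ _ _ => (hW₁ m).eq_of_src _ _⟩ ⟨fun _ _ _ => hI.eq_of_tgt _ _⟩) n hn
  -- `H₂` of the cokernel and `H₁(W)` both vanish, so `H₁` of the image does, and `H₀` of the kernel
  -- embeds in `H₀(V)`.
  have := mono_map_f hS' n 2 1 (by simp) hQ₂
  have hI := (hW₁ n).of_mono ((koszulHomology n 1).map (Abelian.image.ι f))
  have := mono_map_f hS n 1 0 (by simp) hI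
  exact (hV n (by lia)).of_mono ((koszulHomology n 0).map (kernel.ι f))

end FIModule

/-! ### Generation degree of the homology of a complex. -/

theorem mainTheorem2 (C : ChainComplex FIModule.{u} ℤ) (g : ℤ → ℤ)
    (hacyclic : ∀ k : ℤ, (C.X k).IsH0Acyclic)
    (hgen : ∀ k : ℤ, (C.X k).GeneratedInDegreesLE (g k))
    (k : ℤ) (hk : 0 ≤ g k) :
    (C.homology k).GeneratedInDegreesLE
      (if g k > g (k - 1) then g (k - 1) + g k + 1 else 2 * g k) := by
  have h₁ (j : ℤ) (n : ℕ) : IsZero ((FIModule.koszulHomology n 1).obj (C.X j)) :=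
    FIModule.isZero_koszulHomology_one_of_isZero_FIHomology _ (hacyclic j 1 le_rfl) n
  have h₀ (j : ℤ) := (FIModule.generatedInDegreesLE_iff _ _).1 (hgen j)
  have hb := (h₀ (k - 1)).1
  have hQ₀ (n : ℕ) (hn : g (k - 1) < n) :
      IsZero ((FIModule.koszulHomology n 0).obj (cokernel (C.d k (k - 1)))) := by
    have := FIModule.epi_koszulHomology_map (cokernel.π (C.d k (k - 1))) n
    exact ((h₀ (k - 1)).2 n hn).of_epi
      ((FIModule.koszulHomology n 0).map (cokernel.π (C.d k (k - 1))))
  refine (FIModule.generatedInDegreesLE_iff _ _).2 ⟨by split_ifs <;> lia, fun n hn => ?_⟩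
  have hker : IsZero ((FIModule.koszulHomology n 0).obj (kernel (C.d k (k - 1)))) := by
    refine FIModule.isZero_koszulHomology_zero_kernel (C.d k (k - 1)) (g k) _
      (by split_ifs <;> lia) (h₀ k).2 (h₁ (k - 1)) (fun hQ₁ m hm => ?_) n hn
    split_ifs at hm
    -- Generation in degrees `≤ g (k - 1)` means vanishing from `g (k - 1) + 1` on; this is
    -- nonnegative because degrees are at least `-1`, so `toNat` loses nothing.
    · exact FIModule.isZero_koszulHomology_two_of_lt_add (g (k - 1) + 1).toNat (g k) _
        (fun l hl => hQ₀ l (by lia)) hQ₁ m (by lia)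
    · exact FIModule.isZero_koszulHomology_two_of_lt_two_mul (g (k - 1) + 1).toNat (g k).toNat _
        (fun l hl => hQ₀ l (by lia)) (fun l hl => hQ₁ l (by lia)) m (by lia)
  -- The homology is a quotient of the cycles, so it inherits their generation bound.
  let e : kernel (C.d k (k - 1)) ≅ C.cycles k :=
    (kernelIsKernel (C.d k (k - 1))).conePointUniqueUpToIso (C.cyclesIsKernel k (k - 1) (by simp))
  have := FIModule.epi_koszulHomology_map (e.hom ≫ C.homologyπ k) n
  exact hker.of_epi ((FIModule.koszulHomology n 0).map (e.hom ≫ C.homologyπ k))
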